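/- Let $\Gamma$ be a finitely generated discrete group with a fixed finite generating set $S=S^{-1}$, and let $\Gamma_0\supseteq\Gamma_1\supseteq\Gamma_2\supseteq\cdots$ be a nested sequence of finite index normal subgroups of $\Gamma$ with $\bigcap_n\Gamma_n=\{e\}$. Let $X=\bigsqcup_{n}\Gamma/\Gamma_n$, equipped with the coarse structure generated by $$\bigsqcup_n\{(x,y)\in \Gamma/\Gamma_n\times\Gamma/\Gamma_n : x^{-1}y\in S\},$$ where $S$ also denotes its image in $\Gamma/\Gamma_n$. Then $X$ has geometric property (T) if and only if $\Gamma$ has Kazhdan's property (T). Here the following definitions are used. A coarse structure on $X$ is a family of subsets of $X\times X$ (the controlled sets) that contains the diagonal and is closed under subsets, finite unions, compositions and inverses. A controlled set $E$ is generating if every controlled set is contained in some iterated composition $E^{\circ n}$, $n\ge 1$. The translation algebra $\mathbb{C}_u[X]$ is the $*$-algebra of all $X\times X$ complex matrices with uniformly bounded entries and controlled support. A partial translation is a matrix $v\in\mathbb{C}_u[X]$ of the form $v_{xy}=1$ if $y\in A$ and $t(y)=x$, and $v_{xy}=0$ otherwise, for a bijection $t:A\to B$ between subsets of $X$ whose graph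 $\{(t(y),y):y\in A\}$ is controlled. A representation of $\mathbb{C}_u[X]$ is a unital $*$-homomorphism to the bounded operators on a Hilbert space $H$; its constant vectors are $$H_c=\{\xi\in H : v\xi=vv^*\xi\text{ for all partial translations }v\}.$$ The space $X$ has geometric property (T) if for every controlled generating set $E$ there is $c>0$ such that for every representation $H$ of $\mathbb{C}_u[X]$ and every $\xi\in H_c^\perp$ there is a partial translation $v$ with support in $E$ such that $\|(vv^*-v)\xi\|\ge c\|\xi\|$. The group $\Gamma$ has property (T) if for every finite generating set $E$ of $\Gamma$ there is $c>0$ such that for every unitary representation of $\Gamma$ on a Hilbert space $H$ and every nonzero $\xi$ orthogonal to the $\Gamma$-fixed vectors there is $g\in E$ with $\|g\xi-\xi\|\ge c\|\xi\|$. -/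

import Mathlib

universe u

/-! ### Coarse structures -/

/-- A (unital) coarse structure on a set `X`: a family of relations on `X`, called *controlled*,
that contains the diagonal and is closed under subsets, finite unions, compositions and
inverses. -/
structure CoarseStructure (X : Type u) where
  controlled : Set (SetRel X X)
  diag_mem : (SetRel.id : SetRel X X) ∈ controlled
  subset_mem : ∀ {E F : SetRel X X}, E ∈ controlled → F ⊆ E → F ∈ controlled
  union_mem : ∀ {E F : SetRel X X}, E ∈ controlled → F ∈ controlled → E ∪ F ∈ controlled
  comp_mem : ∀ {E F : SetRel X X}, E ∈ controlled → F ∈ controlled → E.comp F ∈ controlled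
  inv_mem : ∀ {E : SetRel X X}, E ∈ controlled → E.inv ∈ controlled

/-- The iterated composition `E ∘ ⋯ ∘ E` (`n` factors; the diagonal when `n = 0`). -/
def relPow {X : Type u} (E : SetRel X X) : ℕ → SetRel X X
  | 0 => SetRel.id
  | n + 1 => (relPow E n).comp E

namespace CoarseStructure

variable {X : Type u}

/-- The coarse structure generated by a relation `E`: its controlled sets are those that are
controlled for every coarse structure for which `E` is controlled. -/
def generatedBy (E : SetRel X X) : CoarseStructure X where
  controlled := {F | ∀ 𝓔 : CoarseStructure X, E ∈ 𝓔.controlled → F ∈ 𝓔.controlled}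
  diag_mem := fun 𝓔 _ => 𝓔.diag_mem
  subset_mem := fun h hs 𝓔 hE => 𝓔.subset_mem (h 𝓔 hE) hs
  union_mem := fun h h' 𝓔 hE => 𝓔.union_mem (h 𝓔 hE) (h' 𝓔 hE)
  comp_mem := fun h h' 𝓔 hE => 𝓔.comp_mem (h 𝓔 hE) (h' 𝓔 hE)
  inv_mem := fun h 𝓔 hE => 𝓔.inv_mem (h 𝓔 hE)

/-- `E` is a controlled generating set: it is controlled, and every controlled set is contained
in `E ∘ ⋯ ∘ E` with some number `n ≥ 1` of factors. -/
def IsGenerating (𝓔 : CoarseStructure X) (E : SetRel X X) : Prop :=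
  E ∈ 𝓔.controlled ∧ ∀ F ∈ 𝓔.controlled, ∃ n : ℕ, 1 ≤ n ∧ F ⊆ relPow E n

/-- Two points are in the same coarse component if the pair formed by them is controlled. -/
def componentSetoid (𝓔 : CoarseStructure X) : Setoid X where
  r x y := ({(x, y)} : SetRel X X) ∈ 𝓔.controlled
  iseqv :=
    { refl := fun x => 𝓔.subset_mem 𝓔.diag_mem (by rintro _ rfl; rfl)
      symm := fun {x y} h => 𝓔.subset_mem (𝓔.inv_mem h) (by rintro _ rfl; rfl)
      trans := fun {x y z} h h' => 𝓔.subset_mem (𝓔.comp_mem h h')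
        (by rintro _ rfl; exact ⟨y, rfl, rfl⟩) }

/-- There is a uniform finite bound on the number of points related to a given point. -/
def UniformlyLocallyFinite (F : SetRel X X) : Prop :=
  ∃ M : ℕ, ∀ x : X, {y | (x, y) ∈ F ∪ F.inv}.encard ≤ M

/-- A *space*: a bounded geometry, monogenic coarse space with at most countably many coarse
components. -/
class IsSpace (𝓔 : CoarseStructure X) : Prop where
  bounded_geometry : ∀ F ∈ 𝓔.controlled, UniformlyLocallyFinite F
  monogenic : ∃ E, 𝓔.IsGenerating E
  countable_components : Countable (Quotient 𝓔.componentSetoid)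

end CoarseStructure

/-! ### The translation algebra -/

section TranslationAlgebra

variable {X : Type u}

/-- The translation algebra `ℂ_u[X]`, as a vector space: the `X`-by-`X` complex matrices with
uniformly bounded entries and controlled support. -/
def translationSubmodule (𝓔 : CoarseStructure X) : Submodule ℂ (Matrix X X ℂ) where
  carrier := {T | (∃ C : ℝ, ∀ x y, ‖T x y‖ ≤ C) ∧ {p : X × X | T p.1 p.2 ≠ 0} ∈ 𝓔.controlled}
  zero_mem' := ⟨⟨0, by simp⟩, 𝓔.subset_mem 𝓔.diag_mem (by simp)⟩
  add_mem' := by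
    rintro S T ⟨⟨C, hC⟩, hS⟩ ⟨⟨D, hD⟩, hT⟩
    refine ⟨⟨C + D, fun x y => (norm_add_le _ _).trans (add_le_add (hC x y) (hD x y))⟩,
      𝓔.subset_mem (𝓔.union_mem hS hT) ?_⟩
    intro p hp
    by_contra h
    simp only [Set.mem_union, Set.mem_ofPred_eq, not_or, not_not] at h
    exact hp (by simp [h.1, h.2])
  smul_mem' := by
    rintro c T ⟨⟨C, hC⟩, hT⟩
    refine ⟨⟨‖c‖ * C, fun x y => ?_⟩, 𝓔.subset_mem hT ?_⟩
    · simpa using mul_le_mul_of_nonneg_left (hC x y) (norm_nonneg c)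
    · intro p hp h
      exact hp (by simp [h])

/-- The translation algebra `ℂ_u[X]` of a coarse space. -/
def TranslationAlgebra (𝓔 : CoarseStructure X) : Type u := translationSubmodule 𝓔

namespace TranslationAlgebra

variable {𝓔 : CoarseStructure X}

noncomputable instance : AddCommGroup (TranslationAlgebra 𝓔) :=
  inferInstanceAs (AddCommGroup (translationSubmodule 𝓔))

noncomputable instance : Module ℂ (TranslationAlgebra 𝓔) :=
  inferInstanceAs (Module ℂ (translationSubmodule 𝓔))

/-- The matrix coefficient `T_{xy}`. -/
def coeff (T : TranslationAlgebra 𝓔) (x y : X) : ℂ := T.1 x y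

/-- The support of a matrix. -/
def supp (T : TranslationAlgebra 𝓔) : SetRel X X := {p | T.coeff p.1 p.2 ≠ 0}

theorem exists_bound (T : TranslationAlgebra 𝓔) : ∃ C : ℝ, ∀ x y, ‖T.coeff x y‖ ≤ C := T.2.1

theorem supp_mem (T : TranslationAlgebra 𝓔) : T.supp ∈ 𝓔.controlled := T.2.2

/-- The element of the translation algebra with given coefficients. -/
def mk (f : X → X → ℂ) (hb : ∃ C : ℝ, ∀ x y, ‖f x y‖ ≤ C)
    (hs : {p : X × X | f p.1 p.2 ≠ 0} ∈ 𝓔.controlled) : TranslationAlgebra 𝓔 :=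
  ⟨f, hb, hs⟩

@[simp] theorem coeff_mk (f : X → X → ℂ) (hb hs) (x y : X) :
    (mk f hb hs : TranslationAlgebra 𝓔).coeff x y = f x y := rfl

@[ext] theorem ext {S T : TranslationAlgebra 𝓔} (h : ∀ x y, S.coeff x y = T.coeff x y) : S = T :=
  Subtype.ext (funext fun x => funext fun y => h x y)

@[simp] theorem coeff_zero (x y : X) : (0 : TranslationAlgebra 𝓔).coeff x y = 0 := rfl

@[simp] theorem coeff_add (S T : TranslationAlgebra 𝓔) (x y : X) :
    (S + T).coeff x y = S.coeff x y + T.coeff x y := rfl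

@[simp] theorem coeff_smul (c : ℂ) (T : TranslationAlgebra 𝓔) (x y : X) :
    (c • T).coeff x y = c * T.coeff x y := rfl

open scoped Classical in
/-- The identity matrix. -/
noncomputable instance : One (TranslationAlgebra 𝓔) :=
  ⟨mk (fun x y => if x = y then 1 else 0)
    ⟨1, fun x y => by split_ifs <;> simp⟩
    (𝓔.subset_mem 𝓔.diag_mem fun p hp => by
      by_contra h
      exact hp (if_neg h))⟩

open scoped Classical in
theorem coeff_one (x y : X) :
    (1 : TranslationAlgebra 𝓔).coeff x y = if x = y then 1 else 0 := rfl

/-- The adjoint (conjugate transpose) of a matrix. -/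
noncomputable instance : Star (TranslationAlgebra 𝓔) :=
  ⟨fun T => mk (fun x y => star (T.coeff y x))
    (by obtain ⟨C, hC⟩ := T.exists_bound; exact ⟨C, fun x y => by simpa using hC y x⟩)
    (𝓔.subset_mem (𝓔.inv_mem T.supp_mem) fun p hp => by simpa [SetRel.inv, supp] using hp)⟩

@[simp] theorem coeff_star (T : TranslationAlgebra 𝓔) (x y : X) :
    (star T).coeff x y = star (T.coeff y x) := rfl

theorem exists_row_bound [h : 𝓔.IsSpace] (T : TranslationAlgebra 𝓔) :
    ∃ M : ℕ, ∀ x, ∃ s : Finset X, s.card ≤ M ∧ ∀ y, T.coeff x y ≠ 0 → y ∈ s := by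
  obtain ⟨M, hM⟩ := h.bounded_geometry _ T.supp_mem
  refine ⟨M, fun x => ?_⟩
  obtain ⟨hf, n, hn, hnM⟩ := Set.encard_le_coe_iff.1 (hM x)
  refine ⟨hf.toFinset, ?_, fun y hy => ?_⟩
  · rw [hf.encard_eq_coe_toFinset_card] at hn
    have : hf.toFinset.card = n := by exact_mod_cast hn
    omega
  · rw [Set.Finite.mem_toFinset]
    exact Or.inl hy

theorem exists_row [𝓔.IsSpace] (T : TranslationAlgebra 𝓔) (x : X) :
    ∃ s : Finset X, ∀ y, T.coeff x y ≠ 0 → y ∈ s := by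
  obtain ⟨M, hM⟩ := T.exists_row_bound
  exact (hM x).imp fun s hs => hs.2

theorem exists_col [𝓔.IsSpace] (T : TranslationAlgebra 𝓔) (y : X) :
    ∃ s : Finset X, ∀ x, T.coeff x y ≠ 0 → x ∈ s := by
  obtain ⟨s, hs⟩ := (star T).exists_row y
  exact ⟨s, fun x hx => hs x (by simpa using hx)⟩

theorem finsum_eq_of_row (S T : TranslationAlgebra 𝓔) (x y : X) (s : Finset X)
    (hs : ∀ z, S.coeff x z ≠ 0 → z ∈ s) :
    ∑ᶠ z, S.coeff x z * T.coeff z y = ∑ z ∈ s, S.coeff x z * T.coeff z y :=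
  finsum_eq_sum_of_support_subset _ fun z hz => hs z fun h => hz (by simp [h])

theorem finsum_eq_of_col (S T : TranslationAlgebra 𝓔) (x y : X) (s : Finset X)
    (hs : ∀ z, T.coeff z y ≠ 0 → z ∈ s) :
    ∑ᶠ z, S.coeff x z * T.coeff z y = ∑ z ∈ s, S.coeff x z * T.coeff z y :=
  finsum_eq_sum_of_support_subset _ fun z hz => hs z fun h => hz (by simp [h])

/-- Matrix multiplication; by bounded geometry all the sums involved are finite. -/
noncomputable instance [𝓔.IsSpace] : Mul (TranslationAlgebra 𝓔) :=
  ⟨fun S T => mk (fun x y => ∑ᶠ z, S.coeff x z * T.coeff z y)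
    (by
      obtain ⟨C, hC⟩ := S.exists_bound
      obtain ⟨D, hD⟩ := T.exists_bound
      obtain ⟨M, hM⟩ := S.exists_row_bound
      refine ⟨M * (|C| * |D|), fun x y => ?_⟩
      obtain ⟨s, hs, hs'⟩ := hM x
      rw [finsum_eq_of_row S T x y s hs']
      refine (norm_sum_le_of_le s (f := fun z => S.coeff x z * T.coeff z y)
        (n := fun _ => |C| * |D|) fun z _ => ?_).trans ?_
      · rw [norm_mul]
        exact mul_le_mul ((hC x z).trans (le_abs_self C)) ((hD z y).trans (le_abs_self D))
          (norm_nonneg _) (abs_nonneg _)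
      · rw [Finset.sum_const, nsmul_eq_mul]
        exact mul_le_mul_of_nonneg_right (by exact_mod_cast hs) (by positivity))
    (𝓔.subset_mem (𝓔.comp_mem S.supp_mem T.supp_mem) fun p hp => by
      obtain ⟨z, hz⟩ : ∃ z, S.coeff p.1 z * T.coeff z p.2 ≠ 0 := by
        by_contra! h
        exact hp (finsum_eq_zero_of_forall_eq_zero h)
      exact ⟨z, left_ne_zero_of_mul hz, right_ne_zero_of_mul hz⟩)⟩

theorem coeff_mul [𝓔.IsSpace] (S T : TranslationAlgebra 𝓔) (x y : X) :
    (S * T).coeff x y = ∑ᶠ z, S.coeff x z * T.coeff z y := rfl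

theorem coeff_mul_of_row [𝓔.IsSpace] (S T : TranslationAlgebra 𝓔) (x y : X) (s : Finset X)
    (hs : ∀ z, S.coeff x z ≠ 0 → z ∈ s) :
    (S * T).coeff x y = ∑ z ∈ s, S.coeff x z * T.coeff z y :=
  finsum_eq_of_row S T x y s hs

theorem coeff_mul_of_col [𝓔.IsSpace] (S T : TranslationAlgebra 𝓔) (x y : X) (s : Finset X)
    (hs : ∀ z, T.coeff z y ≠ 0 → z ∈ s) :
    (S * T).coeff x y = ∑ z ∈ s, S.coeff x z * T.coeff z y :=
  finsum_eq_of_col S T x y s hs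

noncomputable instance [𝓔.IsSpace] : Ring (TranslationAlgebra 𝓔) where
  __ := (inferInstance : AddCommGroup (TranslationAlgebra 𝓔))
  left_distrib A B C := by
    ext x y
    obtain ⟨s, hs⟩ := A.exists_row x
    simp only [coeff_add, coeff_mul_of_row A _ x y s hs, mul_add,
      Finset.sum_add_distrib]
  right_distrib A B C := by
    ext x y
    obtain ⟨s, hs⟩ := C.exists_col y
    simp only [coeff_add, coeff_mul_of_col _ C x y s hs, add_mul,
      Finset.sum_add_distrib]
  zero_mul A := by ext x y; simp [coeff_mul]
  mul_zero A := by ext x y; simp [coeff_mul]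
  mul_assoc A B C := by
    ext x y
    obtain ⟨s, hs⟩ := A.exists_row x
    obtain ⟨t, ht⟩ := C.exists_col y
    rw [coeff_mul_of_col _ C x y t ht, coeff_mul_of_row A _ x y s hs]
    simp only [coeff_mul_of_row A _ x _ s hs, coeff_mul_of_col _ C _ y t ht,
      Finset.sum_mul, Finset.mul_sum]
    rw [Finset.sum_comm]
    simp only [mul_assoc]
  one_mul A := by
    classical
    ext x y
    rw [coeff_mul, finsum_eq_single _ x (fun z hz => by simp [coeff_one, Ne.symm hz])]
    simp [coeff_one]
  mul_one A := by
    classical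
    ext x y
    rw [coeff_mul, finsum_eq_single _ y (fun z hz => by simp [coeff_one, hz])]
    simp [coeff_one]
  zsmul := (inferInstance : AddCommGroup (TranslationAlgebra 𝓔)).zsmul
  neg_add_cancel := neg_add_cancel

noncomputable instance [𝓔.IsSpace] : Algebra ℂ (TranslationAlgebra 𝓔) :=
  Algebra.ofModule
    (fun c A B => by
      ext x y
      obtain ⟨s, hs⟩ := B.exists_col y
      simp only [coeff_smul, coeff_mul_of_col _ B x y s hs, Finset.mul_sum, mul_assoc])
    (fun c A B => by
      ext x y
      obtain ⟨s, hs⟩ := A.exists_row x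
      simp only [coeff_smul, coeff_mul_of_row A _ x y s hs, Finset.mul_sum,
        mul_left_comm])

noncomputable instance [𝓔.IsSpace] : StarRing (TranslationAlgebra 𝓔) where
  star_involutive A := by ext x y; simp
  star_mul A B := by
    ext x y
    obtain ⟨t, ht⟩ := B.exists_col x
    rw [coeff_star, coeff_mul_of_col A B y x t ht,
      coeff_mul_of_row (star B) (star A) x y t (fun z hz => ht z (by simpa using hz)), star_sum]
    simp only [coeff_star, star_mul]
  star_add A B := by ext x y; simp

instance [𝓔.IsSpace] : StarModule ℂ (TranslationAlgebra 𝓔) :=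
  ⟨fun c A => by ext x y; simp⟩

end TranslationAlgebra

end TranslationAlgebra

/-! ### Partial translations and geometric property (T) -/

/-- A partial translation: a bijection `t : A → B` between subsets of `X` whose graph
`{(t(x), x) | x ∈ A}` is controlled. -/
structure PartialTranslation {X : Type u} (𝓔 : CoarseStructure X) where
  source : Set X
  target : Set X
  toEquiv : source ≃ target
  graph_mem : {p : X × X | ∃ a : source, p.1 = toEquiv a ∧ p.2 = a} ∈ 𝓔.controlled

namespace PartialTranslation

variable {X : Type u} {𝓔 : CoarseStructure X}

/-- The graph `{(t(x), x) | x ∈ A}` of a partial translation `t : A → B`. -/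
def graph (t : PartialTranslation 𝓔) : SetRel X X :=
  {p | ∃ a : t.source, p.1 = t.toEquiv a ∧ p.2 = a}

open scoped Classical in
/-- The matrix `v` of a partial translation `t`: `v_{xy} = 1` if `t(y) = x`, and `0` otherwise. -/
noncomputable def operator (t : PartialTranslation 𝓔) : TranslationAlgebra 𝓔 :=
  TranslationAlgebra.mk (fun x y => if (x, y) ∈ t.graph then 1 else 0)
    ⟨1, fun x y => by split_ifs <;> simp⟩
    (𝓔.subset_mem t.graph_mem fun p hp => by
      by_contra h
      exact hp (if_neg h))

end PartialTranslation

/-- The closed subspace `H_c` of constant vectors of a representation of `ℂ_u[X]`: the vectors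
`ξ` with `v ξ = v v* ξ` for all partial translations `v`. -/
def constantVectors {X : Type u} {𝓔 : CoarseStructure X} [𝓔.IsSpace] {H : Type u}
    [NormedAddCommGroup H] [InnerProductSpace ℂ H] [CompleteSpace H]
    (π : TranslationAlgebra 𝓔 →⋆ₐ[ℂ] (H →L[ℂ] H)) : Submodule ℂ H where
  carrier := {ξ | ∀ t : PartialTranslation 𝓔,
    π t.operator ξ = π (t.operator * star t.operator) ξ}
  zero_mem' := fun t => by simp
  add_mem' := fun {ξ η} hξ hη t => by rw [map_add, map_add, hξ t, hη t]
  smul_mem' := fun c ξ hξ t => by rw [map_smul, map_smul, hξ t]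

/-- Geometric property (T) of a space: for every controlled generating set `E` there is `c > 0`
such that for every representation of `ℂ_u[X]` (a unital `*`-homomorphism into the bounded
operators on a Hilbert space `H`) and every `ξ` orthogonal to the constant vectors, there is a
partial translation `v` supported in `E` with `‖(v v* - v) ξ‖ ≥ c ‖ξ‖`. -/
def HasGeometricPropertyT {X : Type u} (𝓔 : CoarseStructure X) [𝓔.IsSpace] : Prop :=
  ∀ E : SetRel X X, 𝓔.IsGenerating E → ∃ c : ℝ, 0 < c ∧
    ∀ (H : Type u) [NormedAddCommGroup H] [InnerProductSpace ℂ H] [CompleteSpace H]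
      (π : TranslationAlgebra 𝓔 →⋆ₐ[ℂ] (H →L[ℂ] H)), ∀ ξ ∈ (constantVectors π)ᗮ,
      ∃ t : PartialTranslation 𝓔, t.operator.supp ⊆ E ∧
        c * ‖ξ‖ ≤ ‖π (t.operator * star t.operator - t.operator) ξ‖

/-! ### Kazhdan's property (T) -/

/-- The closed subspace of vectors fixed by a unitary representation of a group. -/
def fixedVectors {Γ : Type u} [Group Γ] {H : Type u}
    [NormedAddCommGroup H] [InnerProductSpace ℂ H] [CompleteSpace H]
    (ρ : Γ →* unitary (H →L[ℂ] H)) : Submodule ℂ H where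
  carrier := {ξ | ∀ g : Γ, (ρ g : H →L[ℂ] H) ξ = ξ}
  zero_mem' := fun g => by simp
  add_mem' := fun {ξ η} hξ hη g => by rw [map_add, hξ g, hη g]
  smul_mem' := fun c ξ hξ g => by rw [map_smul, hξ g]

/-- Kazhdan's property (T) for a (discrete, finitely generated) group: for every finite generating
set `E` there is `c > 0` such that for every unitary representation and every nonzero `ξ`
orthogonal to the fixed vectors there is `g ∈ E` with `‖g ξ - ξ‖ ≥ c ‖ξ‖`. -/
def HasKazhdanPropertyT (Γ : Type u) [Group Γ] : Prop :=
  ∀ E : Finset Γ, Subgroup.closure (E : Set Γ) = ⊤ → ∃ c : ℝ, 0 < c ∧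
    ∀ (H : Type u) [NormedAddCommGroup H] [InnerProductSpace ℂ H] [CompleteSpace H]
      (ρ : Γ →* unitary (H →L[ℂ] H)), ∀ ξ ∈ (fixedVectors ρ)ᗮ, ξ ≠ 0 →
      ∃ g ∈ E, c * ‖ξ‖ ≤ ‖(ρ g : H →L[ℂ] H) ξ - ξ‖

/-! ### The space built from a sequence of finite quotients -/

section BoxSpace

variable {Γ : Type u} [Group Γ]

/-- The disjoint union of the quotients `Γ / Γ_n`. -/
abbrev BoxSpace (N : ℕ → Subgroup Γ) : Type u := Σ n : ℕ, Γ ⧸ N n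

/-- The union over `n` of the relations `{(x, y) | x⁻¹ y ∈ S}` on `Γ / Γ_n`, where `S` is
identified with its image in the quotient. -/
def boxRel (S : Finset Γ) (N : ℕ → Subgroup Γ) [∀ n, (N n).Normal] :
    SetRel (BoxSpace N) (BoxSpace N) :=
  {p | ∃ (n : ℕ) (x y : Γ ⧸ N n), p = (⟨n, x⟩, ⟨n, y⟩) ∧ ∃ s ∈ S, x⁻¹ * y = (s : Γ ⧸ N n)}

/-- The coarse structure on the disjoint union of the `Γ / Γ_n` generated by `boxRel`. -/
def boxCoarseStructure (S : Finset Γ) (N : ℕ → Subgroup Γ) [∀ n, (N n).Normal] :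
    CoarseStructure (BoxSpace N) :=
  CoarseStructure.generatedBy (boxRel S N)

end BoxSpace

namespace CoarseStructure

variable {X : Type u}

theorem UniformlyLocallyFinite.mono {E F : SetRel X X} (h : UniformlyLocallyFinite E)
    (hs : F ⊆ E) : UniformlyLocallyFinite F := by
  obtain ⟨M, hM⟩ := h
  refine ⟨M, fun x => (Set.encard_le_encard ?_).trans (hM x)⟩
  rintro y (hy | hy)
  · exact Or.inl (hs hy)
  · exact Or.inr (hs hy)

theorem UniformlyLocallyFinite.inv {E : SetRel X X} (h : UniformlyLocallyFinite E) :
    UniformlyLocallyFinite E.inv := by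
  obtain ⟨M, hM⟩ := h
  refine ⟨M, fun x => (Set.encard_le_encard ?_).trans (hM x)⟩
  rintro y (hy | hy)
  · exact Or.inr hy
  · exact Or.inl hy

theorem UniformlyLocallyFinite.union {E F : SetRel X X} (hE : UniformlyLocallyFinite E)
    (hF : UniformlyLocallyFinite F) : UniformlyLocallyFinite (E ∪ F) := by
  obtain ⟨M, hM⟩ := hE
  obtain ⟨K, hK⟩ := hF
  refine ⟨M + K, fun x => ?_⟩
  push_cast
  refine (Set.encard_le_encard ?_).trans
    ((Set.encard_union_le _ _).trans (add_le_add (hM x) (hK x)))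
  rintro y ((hy | hy) | (hy | hy))
  · exact Or.inl (Or.inl hy)
  · exact Or.inr (Or.inl hy)
  · exact Or.inl (Or.inr hy)
  · exact Or.inr (Or.inr hy)

theorem encard_comp_le (E F : SetRel X X) (M K : ℕ)
    (hE : ∀ x, {y | (x, y) ∈ E}.encard ≤ M) (hF : ∀ x, {y | (x, y) ∈ F}.encard ≤ K) (x : X) :
    {y | (x, y) ∈ E.comp F}.encard ≤ (M * K : ℕ) := by
  obtain ⟨hf, m, hm, hmM⟩ := Set.encard_le_coe_iff.1 (hE x)
  have hc : hf.toFinset.card ≤ M := by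
    rw [hf.encard_eq_coe_toFinset_card] at hm
    have : hf.toFinset.card = m := by exact_mod_cast hm
    omega
  have hsub : {y | (x, y) ∈ E.comp F} ⊆ ⋃ z ∈ hf.toFinset, {y | (z, y) ∈ F} := by
    rintro y ⟨z, hz, hzy⟩
    simp only [Set.mem_iUnion]
    exact ⟨z, by simpa using hz, hzy⟩
  refine (Set.encard_le_encard hsub).trans ((Finset.set_encard_biUnion_le _ _).trans ?_)
  refine (Finset.sum_le_card_nsmul _ _ (K : ℕ∞) fun z _ => hF z).trans ?_
  rw [nsmul_eq_mul]
  push_cast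
  gcongr

theorem UniformlyLocallyFinite.comp {E F : SetRel X X} (hE : UniformlyLocallyFinite E)
    (hF : UniformlyLocallyFinite F) : UniformlyLocallyFinite (E.comp F) := by
  obtain ⟨M, hM⟩ := hE
  obtain ⟨K, hK⟩ := hF
  refine ⟨M * K + K * M, fun x => ?_⟩
  have h1 := encard_comp_le E F M K
    (fun x => (Set.encard_le_encard fun y hy => Or.inl hy).trans (hM x))
    (fun x => (Set.encard_le_encard fun y hy => Or.inl hy).trans (hK x)) x
  have h2 := encard_comp_le F.inv E.inv K M
    (fun x => (Set.encard_le_encard fun y hy => Or.inr hy).trans (hK x))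
    (fun x => (Set.encard_le_encard fun y hy => Or.inr hy).trans (hM x)) x
  rw [← SetRel.inv_comp] at h2
  rw [Nat.cast_add]
  exact (Set.encard_union_le {y | (x, y) ∈ E.comp F} {y | (x, y) ∈ (E.comp F).inv}).trans
    (add_le_add h1 h2)

/-- The coarse structure of all uniformly locally finite relations. -/
def uniformlyLocallyFinite (X : Type u) : CoarseStructure X where
  controlled := {F | UniformlyLocallyFinite F}
  diag_mem := ⟨1, fun x => by
    have : {y | (x, y) ∈ (SetRel.id : SetRel X X) ∪ SetRel.id.inv} ⊆ {x} := by
      rintro y (hy | hy)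
      · exact Eq.symm hy
      · exact hy
    exact (Set.encard_le_encard this).trans (by simp)⟩
  subset_mem := fun h hs => h.mono hs
  union_mem := fun h h' => h.union h'
  comp_mem := fun h h' => h.comp h'
  inv_mem := fun h => h.inv

theorem relPow_add (E : SetRel X X) (m n : ℕ) :
    relPow E (m + n) = (relPow E m).comp (relPow E n) := by
  induction n with
  | zero => simp [relPow]
  | succ n ih => rw [← add_assoc, relPow, ih, relPow, SetRel.comp_assoc]

theorem relPow_mono_exp {E : SetRel X X} (h : SetRel.id ⊆ E) {m n : ℕ} (hmn : m ≤ n) :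
    relPow E m ⊆ relPow E n := by
  induction hmn with
  | refl => exact subset_rfl
  | step _ ih =>
    refine ih.trans fun p hp => ?_
    exact ⟨p.2, hp, h rfl⟩

theorem relPow_inv {E : SetRel X X} (h : E.inv = E) (n : ℕ) :
    (relPow E n).inv = relPow E n := by
  induction n with
  | zero => exact SetRel.inv_id
  | succ n ih =>
    have h1 : relPow E 1 = E := by simp [relPow]
    have : relPow E (n + 1) = E.comp (relPow E n) := by rw [add_comm, relPow_add, h1]
    rw [relPow, SetRel.inv_comp, ih, h, ← this, relPow]

/-- The coarse structure of subsets of the powers of a symmetric relation containing the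
diagonal. -/
def ofPowers (E : SetRel X X) (hd : SetRel.id ⊆ E) (hi : E.inv = E) : CoarseStructure X where
  controlled := {F | ∃ n : ℕ, 1 ≤ n ∧ F ⊆ relPow E n}
  diag_mem := ⟨1, le_rfl, by simpa [relPow] using hd⟩
  subset_mem := fun ⟨n, hn, h⟩ hs => ⟨n, hn, hs.trans h⟩
  union_mem := fun ⟨n, hn, h⟩ ⟨m, _, h'⟩ => ⟨n + m, by omega,
    Set.union_subset (h.trans (relPow_mono_exp hd (by omega)))
      (h'.trans (relPow_mono_exp hd (by omega)))⟩
  comp_mem := fun ⟨n, hn, h⟩ ⟨m, _, h'⟩ => ⟨n + m, by omega, by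
    rw [relPow_add]; exact SetRel.comp_subset_comp h h'⟩
  inv_mem := fun ⟨n, hn, h⟩ => ⟨n, hn, by
    rw [← relPow_inv hi]; exact SetRel.inv_mono h⟩

theorem monogenic_generatedBy (E : SetRel X X) : ∃ D, (generatedBy E).IsGenerating D := by
  have hE : E ∈ (generatedBy E).controlled := fun _ h => h
  refine ⟨SetRel.id ∪ (E ∪ E.inv), (generatedBy E).union_mem (generatedBy E).diag_mem
    ((generatedBy E).union_mem hE ((generatedBy E).inv_mem hE)), fun F hF => ?_⟩
  refine hF (ofPowers (SetRel.id ∪ (E ∪ E.inv)) Set.subset_union_left ?_) ⟨1, le_rfl, ?_⟩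
  · ext ⟨x, y⟩
    simp only [SetRel.inv, Set.mem_preimage, Prod.swap_prod_mk, Set.mem_union, SetRel.mem_id]
    tauto
  · intro p hp
    simpa [relPow] using Or.inr (Or.inl hp)

end CoarseStructure

theorem boxRel_uniformlyLocallyFinite {Γ : Type u} [Group Γ] (S : Finset Γ) (N : ℕ → Subgroup Γ)
    [∀ n, (N n).Normal] : CoarseStructure.UniformlyLocallyFinite (boxRel S N) := by
  classical
  refine ⟨S.card + S.card, fun x => ?_⟩
  obtain ⟨n, a⟩ := x
  have hsub : {y : BoxSpace N | ((⟨n, a⟩ : BoxSpace N), y) ∈ boxRel S N ∪ (boxRel S N).inv} ⊆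
      ((S.image fun s : Γ => (⟨n, a * (s : Γ ⧸ N n)⟩ : BoxSpace N)) ∪
        S.image fun s : Γ => (⟨n, a * (s : Γ ⧸ N n)⁻¹⟩ : BoxSpace N) : Finset (BoxSpace N)) := by
    rintro y (⟨m, b, c, h, s, hs, hbc⟩ | ⟨m, b, c, h, s, hs, hbc⟩)
    · obtain ⟨h1, h2⟩ := Prod.mk.inj h
      obtain ⟨rfl, h1⟩ := Sigma.mk.inj h1
      obtain rfl := eq_of_heq h1
      simp only [Finset.coe_union, Finset.coe_image]
      exact Or.inl ⟨s, hs, by simp [h2, ← hbc]⟩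
    · obtain ⟨h2, h1⟩ := Prod.mk.inj (show (y, (⟨n, a⟩ : BoxSpace N)) = _ from h)
      obtain ⟨rfl, h1⟩ := Sigma.mk.inj h1
      obtain rfl := eq_of_heq h1
      simp only [Finset.coe_union, Finset.coe_image]
      exact Or.inr ⟨s, hs, by simp [h2, ← hbc]⟩
  refine (Set.encard_le_encard hsub).trans ?_
  rw [Set.encard_coe_eq_coe_finsetCard]
  exact_mod_cast (Finset.card_union_le _ _).trans
    (add_le_add Finset.card_image_le Finset.card_image_le)

instance boxCoarseStructure_isSpace {Γ : Type u} [Group Γ] (S : Finset Γ) (N : ℕ → Subgroup Γ)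
    [∀ n, (N n).Normal] [∀ n, (N n).FiniteIndex] : (boxCoarseStructure S N).IsSpace where
  bounded_geometry := fun _ hF =>
    hF (CoarseStructure.uniformlyLocallyFinite _) (boxRel_uniformlyLocallyFinite S N)
  monogenic := CoarseStructure.monogenic_generatedBy _
  countable_components := inferInstance

/-!
Let `X` be the disjoint union of the quotients `Γ / Γ_n`. Right translation by `g : Γ` permutes `X`,
and its graph is controlled, so `Γ` sits in the unitary group of the translation algebra `ℂ_u[X]`.
Conversely every controlled set is covered by the graphs of finitely many right translations
(`BoxSpace.exists_finite_labels`), so a partial translation `v` is a finite sum `∑ 1_{B_g} u_g` of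
cut-down right translations, with disjoint sets `B_g` whose union is the range of `v`
(`exists_operator_eq_sum`). Both implications rest on this description.

*From `Γ` to `X`.* A representation of `ℂ_u[X]` restricts to a unitary representation of `Γ`, and by
the decomposition above every `Γ`-fixed vector is constant (`fixedVectors_le_constantVectors`).
Hence a vector orthogonal to the constant vectors is moved by some generator in `S`. A given
generating controlled set `E` has a power containing the graphs of all generators, and a right
translation that moves along paths of `n` steps in `E` displaces a vector by at most a constant
times the largest displacement under partial translations inside `E` (`norm_proj_sub_le_of_relPow`).

*From `X` to `Γ`.* A unitary representation `σ` of `Γ` on `H` has to be turned into a representation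
of `ℂ_u[X]`. On `H`-valued functions on `Γ / Γ_n` a matrix `T` acts by `(T ξ)(x) = ∑ y, T_{xy}
σ(r_n(x⁻¹ y)) ξ(y)`, where `r_n` selects representatives in `Γ`. As the `Γ_n` decrease to the
trivial group, the `r_n` can be selected so that every `g : Γ` represents its own class for all
large `n` (`exists_representatives`). For each pair of matrices only finitely many group elements
matter, so products and adjoints are respected for all large `n`, and an honest representation
appears on the ultraproduct of these Hilbert spaces (`inducedRep`). Normalized constant functions
embed `H` isometrically and `Γ`-equivariantly, and the embedding sends vectors orthogonal to the
fixed vectors to vectors orthogonal to the constant vectors (`diag_mem_orthogonal_constantVectors`).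
So a partial translation with labels in `S ∪ {1}` displaces the image of such a vector, which forces
some element of `S ∪ {1}` to displace the vector itself (`norm_inducedRep_diag_le`).
-/

/-! ### Ultraproducts of Hilbert spaces -/

section Ultraproduct

open Filter Topology UniformSpace

variable (K : ℕ → Type u) [∀ n, NormedAddCommGroup (K n)] [∀ n, InnerProductSpace ℂ (K n)]

/-- The space of norm-bounded sequences `(ξ n)` with `ξ n ∈ K n`. -/
def boundedSequences : Submodule ℂ (∀ n, K n) where
  carrier := {ξ | ∃ C : ℝ, ∀ n, ‖ξ n‖ ≤ C}
  zero_mem' := ⟨0, by simp⟩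
  add_mem' := fun ⟨C, hC⟩ ⟨D, hD⟩ =>
    ⟨C + D, fun n => (norm_add_le _ _).trans (add_le_add (hC n) (hD n))⟩
  smul_mem' := fun c _ ⟨C, hC⟩ => ⟨‖c‖ * C, fun n => by
    rw [Pi.smul_apply, norm_smul]
    exact mul_le_mul_of_nonneg_left (hC n) (norm_nonneg c)⟩

/-- The norm-bounded sequences, as a type of its own: it carries the seminorm
`lim ‖ξ n‖` along a fixed nonprincipal ultrafilter instead of the supremum norm. -/
def PreUltraproduct : Type u := boundedSequences K

namespace PreUltraproduct

instance : AddCommGroup (PreUltraproduct K) := inferInstanceAs (AddCommGroup (boundedSequences K))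
instance : Module ℂ (PreUltraproduct K) := inferInstanceAs (Module ℂ (boundedSequences K))

variable {K}

/-- The `n`-th term of a bounded sequence. -/
def term (ξ : PreUltraproduct K) (n : ℕ) : K n := ξ.1 n

instance : CoeFun (PreUltraproduct K) (fun _ => ∀ n, K n) := ⟨term⟩

theorem exists_bound (ξ : PreUltraproduct K) : ∃ C : ℝ, ∀ n, ‖ξ n‖ ≤ C := ξ.2

@[simp] theorem add_apply (ξ η : PreUltraproduct K) (n : ℕ) : (ξ + η) n = ξ n + η n := rfl

@[simp] theorem smul_apply (c : ℂ) (ξ : PreUltraproduct K) (n : ℕ) : (c • ξ) n = c • ξ n := rfl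

@[simp] theorem sub_apply (ξ η : PreUltraproduct K) (n : ℕ) : (ξ - η) n = ξ n - η n := rfl

theorem exists_tendsto_inner (ξ η : PreUltraproduct K) :
    ∃ z : ℂ, Tendsto (fun n => inner ℂ (ξ n) (η n)) (hyperfilter ℕ : Filter ℕ) (𝓝 z) := by
  obtain ⟨C, hC⟩ := ξ.exists_bound
  obtain ⟨D, hD⟩ := η.exists_bound
  have hC0 : 0 ≤ C := (norm_nonneg _).trans (hC 0)
  obtain ⟨z, -, hz⟩ := (isCompact_closedBall (0 : ℂ) (C * D)).ultrafilter_le_nhds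
    ((hyperfilter ℕ).map fun n => inner ℂ (ξ n) (η n)) (by
      rw [le_principal_iff]
      refine Filter.mem_map.2 (Eventually.of_forall fun n => ?_)
      refine mem_closedBall_zero_iff.2 ?_
      exact (norm_inner_le_norm _ _).trans (mul_le_mul (hC n) (hD n) (norm_nonneg _) hC0))
  exact ⟨z, hz⟩

/-- The positive semidefinite form `lim ⟪ξ n, η n⟫` on bounded sequences. -/
noncomputable abbrev core : PreInnerProductSpace.Core ℂ (PreUltraproduct K) :=
  have key (ξ η : PreUltraproduct K) := tendsto_nhds_limUnder (exists_tendsto_inner ξ η)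
  { inner := fun ξ η => limUnder (hyperfilter ℕ : Filter ℕ) fun n => inner ℂ (ξ n) (η n)
    conj_inner_symm := fun ξ η => tendsto_nhds_unique
      (((Complex.continuous_conj.tendsto _).comp (key η ξ)).congr fun _ => inner_conj_symm _ _)
      (key ξ η)
    re_inner_nonneg := fun ξ => ge_of_tendsto' ((Complex.continuous_re.tendsto _).comp (key ξ ξ))
      fun _ => inner_self_nonneg (𝕜 := ℂ)
    add_left := fun ξ η ζ => tendsto_nhds_unique (key (ξ + η) ζ)
      (((key ξ ζ).add (key η ζ)).congr fun _ => (inner_add_left _ _ _).symm)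
    smul_left := fun ξ η c => tendsto_nhds_unique (key (c • ξ) η)
      (((key ξ η).const_mul _).congr fun _ => (inner_smul_left _ _ _).symm) }

noncomputable instance : SeminormedAddCommGroup (PreUltraproduct K) :=
  InnerProductSpace.Core.toSeminormedAddCommGroup (c := core)

noncomputable instance : InnerProductSpace ℂ (PreUltraproduct K) :=
  InnerProductSpace.ofCore core

theorem tendsto_inner (ξ η : PreUltraproduct K) :
    Tendsto (fun n => inner ℂ (ξ n) (η n)) (hyperfilter ℕ : Filter ℕ) (𝓝 (inner ℂ ξ η)) :=
  tendsto_nhds_limUnder (exists_tendsto_inner ξ η)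

theorem tendsto_norm (ξ : PreUltraproduct K) :
    Tendsto (fun n => ‖ξ n‖) (hyperfilter ℕ : Filter ℕ) (𝓝 ‖ξ‖) := by
  have h := (Real.continuous_sqrt.tendsto _).comp
    ((Complex.continuous_re.tendsto _).comp (tendsto_inner ξ ξ))
  have h2 : √(inner ℂ ξ ξ).re = ‖ξ‖ := (norm_eq_sqrt_re_inner (𝕜 := ℂ) ξ).symm
  rw [h2] at h
  exact h.congr fun n => (norm_eq_sqrt_re_inner (𝕜 := ℂ) (ξ n)).symm

theorem norm_le {ξ : PreUltraproduct K} {C : ℝ}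
    (h : ∀ᶠ n in (hyperfilter ℕ : Filter ℕ), ‖ξ n‖ ≤ C) : ‖ξ‖ ≤ C :=
  le_of_tendsto (tendsto_norm ξ) h

/-- Bounded sequences that agree almost everywhere along the ultrafilter have the same class. -/
theorem coe_eq_coe {ξ η : PreUltraproduct K}
    (h : ∀ᶠ n in (hyperfilter ℕ : Filter ℕ), ξ n = η n) :
    (ξ : Completion (PreUltraproduct K)) = η := by
  rw [← sub_eq_zero, ← Completion.coe_sub, ← norm_le_zero_iff, Completion.norm_coe]
  exact norm_le (h.mono fun n hn => by simp [hn])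

end PreUltraproduct

/-- The ultraproduct of the Hilbert spaces `K n` along a fixed nonprincipal ultrafilter on `ℕ`.
Completing the seminormed space of bounded sequences also divides by the null sequences. -/
abbrev Ultraproduct : Type u := Completion (PreUltraproduct K)

namespace Ultraproduct

variable {K}

/-- The action of a uniformly bounded sequence of operators on bounded sequences. -/
noncomputable def preMap (T : ∀ n, K n →L[ℂ] K n) (hT : ∃ C : ℝ, ∀ n, ‖T n‖ ≤ C) :
    PreUltraproduct K →L[ℂ] PreUltraproduct K :=
  LinearMap.mkContinuousOfExistsBound
    { toFun := fun ξ => ⟨fun n => T n (ξ n), by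
        obtain ⟨C, hC⟩ := hT
        obtain ⟨D, hD⟩ := ξ.exists_bound
        have hC0 : 0 ≤ C := (norm_nonneg _).trans (hC 0)
        exact ⟨C * D, fun n => (T n).le_of_opNorm_le_of_le (hC n) (hD n)⟩⟩
      map_add' := fun ξ η => Subtype.ext (funext fun n => map_add (T n) (ξ n) (η n))
      map_smul' := fun c ξ => Subtype.ext (funext fun n => map_smul (T n) c (ξ n)) }
    (by
      obtain ⟨C, hC⟩ := hT
      exact ⟨C, fun ξ => le_of_tendsto_of_tendsto' (PreUltraproduct.tendsto_norm _)
        ((PreUltraproduct.tendsto_norm ξ).const_mul C) fun n => (T n).le_of_opNorm_le (hC n) _⟩)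

@[simp] theorem preMap_apply (T : ∀ n, K n →L[ℂ] K n) (hT) (ξ : PreUltraproduct K) (n : ℕ) :
    preMap T hT ξ n = T n (ξ n) := rfl

/-- The operator on the ultraproduct defined by a uniformly bounded sequence of operators. -/
noncomputable def map (T : ∀ n, K n →L[ℂ] K n) (hT : ∃ C : ℝ, ∀ n, ‖T n‖ ≤ C) :
    Ultraproduct K →L[ℂ] Ultraproduct K :=
  (preMap T hT).completion

theorem map_coe (T : ∀ n, K n →L[ℂ] K n) (hT) (ξ : PreUltraproduct K) :
    map T hT ξ = (preMap T hT ξ : Ultraproduct K) :=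
  ContinuousLinearMap.completion_apply_coe _ _

theorem ext_coe {A B : Ultraproduct K →L[ℂ] Ultraproduct K}
    (h : ∀ ξ : PreUltraproduct K, A ξ = B ξ) : A = B := by
  ext x
  induction x using Completion.induction_on with
  | hp => exact isClosed_eq A.continuous B.continuous
  | ih ξ => exact h ξ

theorem map_eq_one {T : ∀ n, K n →L[ℂ] K n} (hT)
    (h : ∀ᶠ n in (hyperfilter ℕ : Filter ℕ), T n = 1) : map T hT = 1 :=
  ext_coe fun ξ => by
    rw [map_coe]
    exact PreUltraproduct.coe_eq_coe (h.mono fun n hn => by simp [hn])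

theorem map_eq_mul {T A B : ∀ n, K n →L[ℂ] K n} (hT hA hB)
    (h : ∀ᶠ n in (hyperfilter ℕ : Filter ℕ), T n = A n * B n) :
    map T hT = map A hA * map B hB :=
  ext_coe fun ξ => by
    rw [mul_apply_eq_comp, map_coe, map_coe, map_coe]
    exact PreUltraproduct.coe_eq_coe (h.mono fun n hn => by simp [hn])

theorem map_eq_add {T A B : ∀ n, K n →L[ℂ] K n} (hT hA hB)
    (h : ∀ᶠ n in (hyperfilter ℕ : Filter ℕ), T n = A n + B n) :
    map T hT = map A hA + map B hB :=
  ext_coe fun ξ => by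
    rw [add_apply, map_coe, map_coe, map_coe, ← Completion.coe_add]
    exact PreUltraproduct.coe_eq_coe (h.mono fun n hn => by simp [hn])

theorem map_eq_smul {T A : ∀ n, K n →L[ℂ] K n} (c : ℂ) (hT hA)
    (h : ∀ᶠ n in (hyperfilter ℕ : Filter ℕ), T n = c • A n) :
    map T hT = c • map A hA :=
  ext_coe fun ξ => by
    rw [smul_apply, map_coe, map_coe, ← Completion.coe_smul]
    exact PreUltraproduct.coe_eq_coe (h.mono fun n hn => by simp [hn])

theorem map_eq_star [∀ n, CompleteSpace (K n)] {T A : ∀ n, K n →L[ℂ] K n} (hT hA)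
    (h : ∀ᶠ n in (hyperfilter ℕ : Filter ℕ), T n = star (A n)) :
    map T hT = star (map A hA) := by
  refine (ContinuousLinearMap.eq_adjoint_iff _ _).2 fun x y => ?_
  induction x, y using Completion.induction_on₂ with
  | hp => apply isClosed_eq <;> fun_prop
  | ih ξ η =>
    rw [map_coe, map_coe, Completion.inner_coe, Completion.inner_coe]
    refine tendsto_nhds_unique (PreUltraproduct.tendsto_inner _ _)
      ((PreUltraproduct.tendsto_inner _ _).congr' (h.mono fun n hn => ?_))
    beta_reduce
    rw [preMap_apply, preMap_apply, hn, ContinuousLinearMap.star_eq_adjoint,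
      ContinuousLinearMap.adjoint_inner_left]

variable {H : Type u} [NormedAddCommGroup H] [InnerProductSpace ℂ H]

/-- The sequence `(J n ξ)` defined by a sequence of isometries `J n : H → K n`. -/
def preDiag (J : ∀ n, H →ₗᵢ[ℂ] K n) : H →ₗ[ℂ] PreUltraproduct K where
  toFun := fun ξ => ⟨fun n => J n ξ, ‖ξ‖, fun n => ((J n).norm_map ξ).le⟩
  map_add' := fun ξ η => Subtype.ext (funext fun n => map_add (J n) ξ η)
  map_smul' := fun c ξ => Subtype.ext (funext fun n => map_smul (J n) c ξ)

@[simp] theorem preDiag_apply (J : ∀ n, H →ₗᵢ[ℂ] K n) (ξ : H) (n : ℕ) :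
    preDiag J ξ n = J n ξ := rfl

theorem norm_preDiag (J : ∀ n, H →ₗᵢ[ℂ] K n) (ξ : H) : ‖preDiag J ξ‖ = ‖ξ‖ :=
  tendsto_nhds_unique (PreUltraproduct.tendsto_norm _)
    (tendsto_const_nhds.congr fun n => ((J n).norm_map ξ).symm)

/-- The map of `H` into the ultraproduct defined by a sequence of isometries `J n : H → K n`. -/
noncomputable def diag (J : ∀ n, H →ₗᵢ[ℂ] K n) : H →L[ℂ] Ultraproduct K :=
  Completion.toComplL.comp ((preDiag J).mkContinuous 1 fun ξ => by
    rw [norm_preDiag, one_mul])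

theorem diag_apply (J : ∀ n, H →ₗᵢ[ℂ] K n) (ξ : H) :
    diag J ξ = (preDiag J ξ : Ultraproduct K) := rfl

theorem norm_diag (J : ∀ n, H →ₗᵢ[ℂ] K n) (ξ : H) : ‖diag J ξ‖ = ‖ξ‖ := by
  rw [diag_apply, Completion.norm_coe, norm_preDiag]

theorem map_diag_eq (J : ∀ n, H →ₗᵢ[ℂ] K n) {T : ∀ n, K n →L[ℂ] K n} (hT) {ξ η : H}
    (h : ∀ᶠ n in (hyperfilter ℕ : Filter ℕ), T n (J n ξ) = J n η) :
    map T hT (diag J ξ) = diag J η := by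
  rw [diag_apply, diag_apply, map_coe]
  exact PreUltraproduct.coe_eq_coe h

end Ultraproduct

end Ultraproduct

/-! ### Diagonal projections and partial translations in the translation algebra -/

namespace TranslationAlgebra

variable {X : Type u} {𝓔 : CoarseStructure X}

theorem coeff_sum {ι : Type*} (s : Finset ι) (T : ι → TranslationAlgebra 𝓔) (x y : X) :
    (∑ i ∈ s, T i).coeff x y = ∑ i ∈ s, (T i).coeff x y := by
  classical
  induction s using Finset.induction_on with
  | empty => simp
  | insert i s hi ih => rw [Finset.sum_insert hi, Finset.sum_insert hi, coeff_add, ih]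

open scoped Classical in
/-- The projection `1_B` onto a set `B` of points: the diagonal matrix of its indicator function. -/
noncomputable def proj (B : Set X) : TranslationAlgebra 𝓔 :=
  mk (fun x y => if x = y ∧ x ∈ B then 1 else 0)
    ⟨1, fun x y => by split_ifs <;> simp⟩
    (𝓔.subset_mem 𝓔.diag_mem fun p hp => by
      by_contra h
      exact hp (if_neg fun h' => h h'.1))

open scoped Classical in
theorem coeff_proj (B : Set X) (x y : X) :
    (proj B : TranslationAlgebra 𝓔).coeff x y = if x = y ∧ x ∈ B then 1 else 0 := rfl

theorem proj_univ : (proj Set.univ : TranslationAlgebra 𝓔) = 1 := by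
  classical
  ext x y
  simp [coeff_proj, coeff_one]

variable [𝓔.IsSpace]

open scoped Classical in
theorem coeff_proj_mul (B : Set X) (T : TranslationAlgebra 𝓔) (x y : X) :
    (proj B * T).coeff x y = if x ∈ B then T.coeff x y else 0 := by
  rw [coeff_mul, finsum_eq_single _ x fun z hz => by simp [coeff_proj, hz.symm]]
  simp [coeff_proj]

/-- A partition of `B` into finitely many fibres of a function decomposes the projection `1_B`. -/
theorem proj_eq_sum {ι : Type*} (B : Set X) (s : Finset ι) (f : X → ι) (hf : ∀ x ∈ B, f x ∈ s) :
    (proj B : TranslationAlgebra 𝓔) = ∑ i ∈ s, proj {x ∈ B | f x = i} := by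
  classical
  ext x y
  rw [coeff_sum]
  simp only [coeff_proj, Set.mem_ofPred_eq]
  by_cases h : x = y ∧ x ∈ B
  · rw [if_pos h, Finset.sum_eq_single (f x)]
    · rw [if_pos ⟨h.1, h.2, rfl⟩]
    · exact fun i _ hi => if_neg fun h' => hi h'.2.2.symm
    · exact fun h' => absurd (hf x h.2) h'
  · rw [if_neg h]
    exact (Finset.sum_eq_zero fun i _ => if_neg fun h' => h ⟨h'.1, h'.2.1⟩).symm

end TranslationAlgebra

namespace PartialTranslation

variable {X : Type u} {𝓔 : CoarseStructure X} (t : PartialTranslation 𝓔)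

open scoped Classical in
theorem coeff_operator (x y : X) :
    t.operator.coeff x y = if (x, y) ∈ t.graph then 1 else 0 := rfl

theorem supp_operator : t.operator.supp = t.graph := by
  classical
  ext ⟨x, y⟩
  change t.operator.coeff x y ≠ 0 ↔ _
  rw [coeff_operator]
  simp

theorem graph_mem_controlled : t.graph ∈ 𝓔.controlled := t.graph_mem

theorem fst_mem_target {x y : X} (h : (x, y) ∈ t.graph) : x ∈ t.target := by
  obtain ⟨a, h1, -⟩ := h
  rw [show x = t.toEquiv a from h1]
  exact (t.toEquiv a).2

theorem exists_mem_graph {x : X} (h : x ∈ t.target) : ∃ y, (x, y) ∈ t.graph :=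
  ⟨t.toEquiv.symm ⟨x, h⟩, t.toEquiv.symm ⟨x, h⟩, by simp, rfl⟩

theorem graph_right_unique {x y z : X} (h : (x, y) ∈ t.graph) (h' : (x, z) ∈ t.graph) : y = z := by
  obtain ⟨a, h1, h2⟩ := h
  obtain ⟨b, h3, h4⟩ := h'
  have hab : a = b := t.toEquiv.injective (Subtype.ext (h1.symm.trans h3))
  exact (h2.trans (congrArg Subtype.val hab)).trans h4.symm

theorem graph_left_unique {x y z : X} (h : (x, z) ∈ t.graph) (h' : (y, z) ∈ t.graph) : x = y := by
  obtain ⟨a, h1, h2⟩ := h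
  obtain ⟨b, h3, h4⟩ := h'
  have hab : a = b := Subtype.ext (h2.symm.trans h4)
  exact (h1.trans (congrArg (fun c => (t.toEquiv c : X)) hab)).trans h3.symm

variable [𝓔.IsSpace]

theorem operator_mul_star : t.operator * star t.operator = TranslationAlgebra.proj t.target := by
  classical
  ext x y
  rw [TranslationAlgebra.coeff_proj]
  by_cases hx : x ∈ t.target
  · obtain ⟨z, hz⟩ := t.exists_mem_graph hx
    rw [TranslationAlgebra.coeff_mul, finsum_eq_single _ z fun w hw => by
      rw [coeff_operator, if_neg fun h => hw (t.graph_right_unique h hz), zero_mul]]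
    have : (y, z) ∈ t.graph ↔ x = y :=
      ⟨fun h => t.graph_left_unique hz h, fun h => h ▸ hz⟩
    rw [TranslationAlgebra.coeff_star, coeff_operator, coeff_operator, if_pos hz]
    simp only [this, hx, and_true]
    split_ifs <;> simp
  · rw [if_neg fun h => hx h.2, TranslationAlgebra.coeff_mul]
    refine finsum_eq_zero_of_forall_eq_zero fun z => ?_
    rw [coeff_operator, if_neg fun h => hx (t.fst_mem_target h), zero_mul]

theorem proj_target_mul_operator :
    TranslationAlgebra.proj t.target * t.operator = t.operator := by
  classical
  ext x y
  rw [TranslationAlgebra.coeff_proj_mul, coeff_operator]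
  split_ifs with h1 h2 h2
  · rfl
  · rfl
  · exact absurd (t.fst_mem_target h2) h1
  · rfl

end PartialTranslation

/-! ### Right translations of the box space -/

namespace BoxSpace

open TranslationAlgebra
open scoped Pointwise

variable {Γ : Type u} [Group Γ] {N : ℕ → Subgroup Γ} [∀ n, (N n).Normal]

/-- Right translation `x ↦ x g` by a group element in every quotient `Γ / Γ_n`. -/
def shift (g : Γ) (x : BoxSpace N) : BoxSpace N := ⟨x.1, x.2 * (g : Γ ⧸ N x.1)⟩

@[simp] theorem shift_one (x : BoxSpace N) : shift 1 x = x := by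
  simp [shift]

@[simp] theorem shift_shift (g h : Γ) (x : BoxSpace N) :
    shift h (shift g x) = shift (g * h) x :=
  congrArg (Sigma.mk x.1) (mul_assoc x.2 (g : Γ ⧸ N x.1) (h : Γ ⧸ N x.1))

theorem shift_injective (g : Γ) : Function.Injective (shift g : BoxSpace N → BoxSpace N) :=
  Function.LeftInverse.injective (g := shift g⁻¹) fun x => by simp

theorem shift_eq_iff {g : Γ} {x y : BoxSpace N} : shift g x = y ↔ x = shift g⁻¹ y := by
  constructor
  · rintro rfl
    simp
  · rintro rfl
    simp

variable (N) in
/-- The relation of all pairs `(x, x g)` with `g` in a given set of group elements. -/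
def labelRel (F : Set Γ) : SetRel (BoxSpace N) (BoxSpace N) :=
  {p | ∃ g ∈ F, p.2 = shift g p.1}

theorem mem_labelRel {F : Set Γ} {x y : BoxSpace N} :
    (x, y) ∈ labelRel N F ↔ ∃ g ∈ F, y = shift g x := Iff.rfl

theorem mk_mem_labelRel_iff {F : Set Γ} {n : ℕ} {x y : Γ ⧸ N n} :
    ((⟨n, x⟩, ⟨n, y⟩) : BoxSpace N × BoxSpace N) ∈ labelRel N F ↔
      ∃ g ∈ F, x⁻¹ * y = (g : Γ ⧸ N n) := by
  refine exists_congr fun g => and_congr_right fun _ => ?_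
  rw [inv_mul_eq_iff_eq_mul]
  exact ⟨fun h => eq_of_heq (Sigma.mk.inj h).2, fun h => by rw [h]; rfl⟩

theorem boxRel_eq_labelRel (S : Finset Γ) : boxRel S N = labelRel N S := by
  ext ⟨⟨n, x⟩, y⟩
  constructor
  · rintro ⟨m, a, b, h, s, hs, hab⟩
    rw [h]
    exact mk_mem_labelRel_iff.2 ⟨s, hs, hab⟩
  · rintro ⟨s, hs, h⟩
    exact ⟨n, x, x * s, Prod.ext rfl h, s, hs, by simp⟩

theorem labelRel_comp (F G : Set Γ) :
    (labelRel N F).comp (labelRel N G) = labelRel N (F * G) := by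
  ext ⟨x, y⟩
  constructor
  · rintro ⟨z, ⟨g, hg, hz⟩, ⟨h, hh, hy⟩⟩
    refine ⟨g * h, Set.mul_mem_mul hg hh, ?_⟩
    change z = shift g x at hz
    change y = shift h z at hy
    change y = shift (g * h) x
    rw [hy, hz, shift_shift]
  · rintro ⟨_, ⟨g, hg, h, hh, rfl⟩, hy⟩
    exact ⟨shift g x, ⟨g, hg, rfl⟩, h, hh, by rw [shift_shift]; exact hy⟩

theorem labelRel_inv (F : Set Γ) : (labelRel N F).inv = labelRel N F⁻¹ := by
  ext ⟨x, y⟩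
  constructor
  · rintro ⟨g, hg, h⟩
    exact ⟨g⁻¹, Set.inv_mem_inv.2 hg, shift_eq_iff.1 (Eq.symm h)⟩
  · rintro ⟨g, hg, h⟩
    exact ⟨g⁻¹, hg, shift_eq_iff.1 (Eq.symm h)⟩

variable (N) in
/-- The coarse structure of all relations contained in `{(x, x g) | g ∈ F}` for some finite set
`F` of group elements. -/
def finiteLabels : CoarseStructure (BoxSpace N) where
  controlled := {E | ∃ F : Set Γ, F.Finite ∧ E ⊆ labelRel N F}
  diag_mem := ⟨{1}, Set.finite_singleton 1, by
    rintro ⟨x, y⟩ h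
    exact ⟨1, rfl, by simpa using Eq.symm h⟩⟩
  subset_mem := fun ⟨F, hF, h⟩ hs => ⟨F, hF, hs.trans h⟩
  union_mem := fun ⟨F, hF, h⟩ ⟨G, hG, h'⟩ => ⟨F ∪ G, hF.union hG, Set.union_subset
    (fun _ hp => (h hp).imp fun _ hg => ⟨Or.inl hg.1, hg.2⟩)
    (fun _ hp => (h' hp).imp fun _ hg => ⟨Or.inr hg.1, hg.2⟩)⟩
  comp_mem := fun ⟨F, hF, h⟩ ⟨G, hG, h'⟩ => ⟨F * G, hF.mul hG, by
    rw [← labelRel_comp]; exact SetRel.comp_subset_comp h h'⟩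
  inv_mem := fun ⟨F, hF, h⟩ => ⟨F⁻¹, hF.inv, by
    rw [← labelRel_inv]; exact SetRel.inv_mono h⟩

variable {S : Finset Γ}

theorem exists_finite_labels {E : SetRel (BoxSpace N) (BoxSpace N)}
    (hE : E ∈ (boxCoarseStructure S N).controlled) : ∃ F : Set Γ, F.Finite ∧ E ⊆ labelRel N F :=
  hE (finiteLabels N) ⟨S, S.finite_toSet, (boxRel_eq_labelRel S).subset⟩

theorem labelRel_singleton_mem (hS : Subgroup.closure (S : Set Γ) = ⊤) (g : Γ) :
    labelRel N {g} ∈ (boxCoarseStructure S N).controlled := by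
  have hg : g ∈ Subgroup.closure (S : Set Γ) := hS ▸ Subgroup.mem_top g
  induction hg using Subgroup.closure_induction with
  | mem s hs =>
    intro 𝓔 h𝓔
    refine 𝓔.subset_mem h𝓔 ?_
    rw [boxRel_eq_labelRel]
    rintro p ⟨_, rfl, h⟩
    exact ⟨_, hs, h⟩
  | one =>
    refine CoarseStructure.subset_mem _ (CoarseStructure.diag_mem _) ?_
    rintro ⟨x, y⟩ ⟨_, rfl, h⟩
    simpa using h.symm
  | mul g h _ _ ihg ihh =>
    have := CoarseStructure.comp_mem _ ihg ihh
    rwa [labelRel_comp, Set.singleton_mul_singleton] at this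
  | inv g _ ih =>
    have := CoarseStructure.inv_mem _ ih
    rwa [labelRel_inv, Set.inv_singleton] at this

theorem exists_label {F : Set Γ} {T : TranslationAlgebra (boxCoarseStructure S N)}
    (hF : T.supp ⊆ labelRel N F) {n : ℕ} {x y : Γ ⧸ N n} (h : T.coeff ⟨n, x⟩ ⟨n, y⟩ ≠ 0) :
    ∃ g ∈ F, x⁻¹ * y = (g : Γ ⧸ N n) :=
  mk_mem_labelRel_iff.1 (hF h)

variable (N) in
open scoped Classical in
/-- The permutation matrix of the right translation by `g`, whose `(x, y)` entry is `1` precisely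
when `y = x g`. -/
noncomputable def shiftMatrix (hS : Subgroup.closure (S : Set Γ) = ⊤) (g : Γ) :
    TranslationAlgebra (boxCoarseStructure S N) :=
  mk (fun x y => if y = shift g x then 1 else 0)
    ⟨1, fun x y => by split_ifs <;> simp⟩
    (CoarseStructure.subset_mem _ (labelRel_singleton_mem hS g) fun p hp => by
      by_contra h
      exact hp (if_neg fun h' => h ⟨g, rfl, h'⟩))

variable (hS : Subgroup.closure (S : Set Γ) = ⊤)

open scoped Classical in
theorem coeff_shiftMatrix (g : Γ) (x y : BoxSpace N) :
    (shiftMatrix N hS g).coeff x y = if y = shift g x then 1 else 0 := rfl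

theorem star_shiftMatrix (g : Γ) : star (shiftMatrix N hS g) = shiftMatrix N hS g⁻¹ := by
  classical
  ext x y
  rw [coeff_star, coeff_shiftMatrix, coeff_shiftMatrix,
    if_congr (eq_comm.trans (shift_eq_iff (g := g) (x := y) (y := x))) rfl rfl]
  split_ifs <;> simp

theorem shiftMatrix_one : shiftMatrix N hS 1 = 1 := by
  classical
  ext x y
  simp [coeff_shiftMatrix, coeff_one, eq_comm]

variable (N) in
/-- The partial translation `x g ↦ x`, for `x` in a given set `B`. -/
noncomputable def shiftPartial (g : Γ) (B : Set (BoxSpace N)) :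
    PartialTranslation (boxCoarseStructure S N) where
  source := shift g '' B
  target := B
  toEquiv := (Equiv.Set.image (shift g) B (shift_injective g)).symm
  graph_mem := CoarseStructure.subset_mem _ (labelRel_singleton_mem hS g) (by
    rintro ⟨x, y⟩ ⟨⟨_, b, hb, rfl⟩, hx, hy⟩
    refine ⟨g, rfl, ?_⟩
    have : (Equiv.Set.image (shift g) B (shift_injective g)).symm ⟨shift g b, b, hb, rfl⟩
        = ⟨b, hb⟩ := by
      rw [Equiv.symm_apply_eq]
      rfl
    rw [this] at hx
    exact hy.trans (congrArg (shift g) hx.symm))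

theorem mem_graph_shiftPartial {g : Γ} {B : Set (BoxSpace N)} {x y : BoxSpace N} :
    (x, y) ∈ (shiftPartial N hS g B).graph ↔ x ∈ B ∧ y = shift g x := by
  have key (b : BoxSpace N) (hb : b ∈ B) :
      (Equiv.Set.image (shift g) B (shift_injective g)).symm ⟨shift g b, b, hb, rfl⟩
        = ⟨b, hb⟩ := by
    rw [Equiv.symm_apply_eq]
    rfl
  constructor
  · rintro ⟨⟨_, b, hb, rfl⟩, hx, hy⟩
    have hx' : x = b := hx.trans (congrArg Subtype.val (key b hb))
    exact ⟨hx' ▸ hb, hx' ▸ hy⟩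
  · rintro ⟨hx, rfl⟩
    exact ⟨⟨shift g x, x, hx, rfl⟩, (congrArg Subtype.val (key x hx)).symm, rfl⟩

theorem target_shiftPartial (g : Γ) (B : Set (BoxSpace N)) :
    (shiftPartial N hS g B).target = B := rfl

variable [∀ n, (N n).FiniteIndex]

theorem coeff_shiftMatrix_mul (g : Γ) (T : TranslationAlgebra (boxCoarseStructure S N))
    (x y : BoxSpace N) : (shiftMatrix N hS g * T).coeff x y = T.coeff (shift g x) y := by
  rw [coeff_mul, finsum_eq_single _ (shift g x) fun z hz => by simp [coeff_shiftMatrix, hz]]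
  simp [coeff_shiftMatrix]

theorem shiftMatrix_mul (g h : Γ) :
    shiftMatrix N hS (g * h) = shiftMatrix N hS g * shiftMatrix N hS h := by
  ext x y
  rw [coeff_shiftMatrix_mul, coeff_shiftMatrix, coeff_shiftMatrix, shift_shift]

variable (N) in
/-- The group `Γ` inside the unitary group of the translation algebra, by right translations. -/
noncomputable def shiftHom : Γ →* unitary (TranslationAlgebra (boxCoarseStructure S N)) where
  toFun := fun g => ⟨shiftMatrix N hS g, by
    rw [Unitary.mem_iff, star_shiftMatrix, ← shiftMatrix_mul, ← shiftMatrix_mul]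
    simp [shiftMatrix_one]⟩
  map_one' := Subtype.ext (shiftMatrix_one hS)
  map_mul' := fun g h => Subtype.ext (shiftMatrix_mul hS g h)

/-- The set `shift g⁻¹ ⁻¹' B` is the translate `B g`. -/
theorem proj_mul_shiftMatrix (B : Set (BoxSpace N)) (g : Γ) :
    proj B * shiftMatrix N hS g = shiftMatrix N hS g * proj (shift g⁻¹ ⁻¹' B) := by
  classical
  ext x y
  rw [coeff_proj_mul, coeff_shiftMatrix_mul, coeff_proj, coeff_shiftMatrix]
  by_cases h : y = shift g x
  · subst h
    simp
  · simp [h, Ne.symm h]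

theorem operator_shiftPartial (g : Γ) (B : Set (BoxSpace N)) :
    (shiftPartial N hS g B).operator = proj B * shiftMatrix N hS g := by
  classical
  ext x y
  rw [coeff_proj_mul, PartialTranslation.coeff_operator, coeff_shiftMatrix,
    if_congr (mem_graph_shiftPartial hS) rfl rfl, ite_and]

end BoxSpace

/-! ### Property (T) of the group implies geometric property (T) of the box space -/

section GroupToSpace

open TranslationAlgebra BoxSpace

theorem norm_unitary_apply {H : Type u} [NormedAddCommGroup H] [InnerProductSpace ℂ H]
    [CompleteSpace H] (U : unitary (H →L[ℂ] H)) (ξ : H) : ‖(U : H →L[ℂ] H) ξ‖ = ‖ξ‖ :=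
  ContinuousLinearMap.norm_map_of_mem_unitary U.2 ξ

variable {X : Type u} {𝓔 : CoarseStructure X} [𝓔.IsSpace]
  {H : Type u} [NormedAddCommGroup H] [InnerProductSpace ℂ H] [CompleteSpace H]

theorem norm_proj_apply_le (π : TranslationAlgebra 𝓔 →⋆ₐ[ℂ] (H →L[ℂ] H)) (B : Set X) (ξ : H) :
    ‖π (proj B) ξ‖ ≤ ‖ξ‖ := by
  have hp : IsStarProjection (proj B : TranslationAlgebra 𝓔) := by
    classical
    constructor
    · ext x y
      rw [coeff_proj_mul, coeff_proj]
      split_ifs with h1 h2 <;> tauto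
    · ext x y
      rw [coeff_star, coeff_proj, coeff_proj]
      by_cases h : x = y
      · subst h
        split_ifs <;> simp
      · simp [h, Ne.symm h]
  have hn : ‖π (proj B)‖ ≤ 1 := (hp.map π).norm_le
  simpa using (π (proj B)).le_of_opNorm_le hn ξ

variable {Γ : Type u} [Group Γ] {N : ℕ → Subgroup Γ} [∀ n, (N n).Normal] [∀ n, (N n).FiniteIndex]
  {S : Finset Γ} (hS : Subgroup.closure (S : Set Γ) = ⊤)
  (π : TranslationAlgebra (boxCoarseStructure S N) →⋆ₐ[ℂ] (H →L[ℂ] H))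

/-- The unitary representation of `Γ` obtained by restricting a representation of the translation
algebra to the right translations. -/
noncomputable def restrictToGroup : Γ →* unitary (H →L[ℂ] H) where
  toFun := fun g => ⟨π (shiftHom N hS g), Unitary.map_mem π (shiftHom N hS g).2⟩
  map_one' := Subtype.ext (by simp)
  map_mul' := fun g h => Subtype.ext (by simp)

theorem restrictToGroup_apply (g : Γ) :
    (restrictToGroup hS π g : H →L[ℂ] H) = π (shiftMatrix N hS g) := rfl

/-- A partial translation is a finite sum of restrictions of right translations to disjoint sets,
which are the fibres of a function `f` assigning to a point of the range the group element that is
used there. -/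
theorem exists_operator_eq_sum (t : PartialTranslation (boxCoarseStructure S N)) (F : Finset Γ)
    (hF : t.graph ⊆ labelRel N F) :
    ∃ f : BoxSpace N → Γ,
      (proj t.target : TranslationAlgebra (boxCoarseStructure S N)) =
        ∑ g ∈ F, proj {x ∈ t.target | f x = g} ∧
      t.operator = ∑ g ∈ F, proj {x ∈ t.target | f x = g} * shiftMatrix N hS g := by
  classical
  have hlabel : ∀ x, ∃ g : Γ, x ∈ t.target → g ∈ F ∧ (x, shift g x) ∈ t.graph := by
    intro x
    by_cases hx : x ∈ t.target
    · obtain ⟨y, hy⟩ := t.exists_mem_graph hx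
      obtain ⟨g, hg, rfl⟩ := mem_labelRel.1 (hF hy)
      exact ⟨g, fun _ => ⟨hg, hy⟩⟩
    · exact ⟨1, fun h => absurd h hx⟩
  choose f hf using hlabel
  have hsum := proj_eq_sum (𝓔 := boxCoarseStructure S N) t.target F f fun x hx => (hf x hx).1
  have hpiece (g : Γ) : proj {x ∈ t.target | f x = g} * t.operator =
      proj {x ∈ t.target | f x = g} * shiftMatrix N hS g := by
    ext x y
    rw [coeff_proj_mul, coeff_proj_mul, PartialTranslation.coeff_operator, coeff_shiftMatrix]
    split_ifs with h1 h2 h3 h3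
    · rfl
    · exact absurd (t.graph_right_unique h2 (h1.2 ▸ (hf x h1.1).2)) h3
    · exact absurd (h3 ▸ h1.2 ▸ (hf x h1.1).2) h2
    · rfl
    · rfl
  refine ⟨f, hsum, ?_⟩
  rw [← t.proj_target_mul_operator, hsum, Finset.sum_mul]
  exact Finset.sum_congr rfl fun g _ => hpiece g

theorem fixedVectors_le_constantVectors :
    fixedVectors (restrictToGroup hS π) ≤ constantVectors π := by
  intro ξ hξ t
  obtain ⟨F, hF, hFt⟩ := exists_finite_labels t.graph_mem_controlled
  obtain ⟨f, hsum, hop⟩ := exists_operator_eq_sum hS t hF.toFinset (by simpa using hFt)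
  have hfix (g : Γ) : π (shiftMatrix N hS g) ξ = ξ := hξ g
  rw [t.operator_mul_star, hsum, hop, map_sum, map_sum, sum_apply, sum_apply]
  refine Finset.sum_congr rfl fun g _ => ?_
  rw [map_mul, mul_apply_eq_comp, hfix]

/-- If every partial translation inside `E` moves `ξ` by at most `δ`, then so do, up to a constant
factor, those right translations, restricted to a set `B` of points, that move along a path of `n`
steps in `E`. -/
theorem norm_proj_sub_le_of_relPow {E : SetRel (BoxSpace N) (BoxSpace N)}
    (hE : E ∈ (boxCoarseStructure S N).controlled) (n : ℕ) :
    ∃ K : ℝ, 0 ≤ K ∧ ∀ (H : Type u) [NormedAddCommGroup H] [InnerProductSpace ℂ H]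
      [CompleteSpace H] (π : TranslationAlgebra (boxCoarseStructure S N) →⋆ₐ[ℂ] (H →L[ℂ] H))
      (ξ : H) (δ : ℝ),
      (∀ (g : Γ) (B : Set (BoxSpace N)), (∀ x ∈ B, (x, shift g x) ∈ E) →
        ‖π (proj B) (ξ - π (shiftMatrix N hS g) ξ)‖ ≤ δ) →
      ∀ (g : Γ) (B : Set (BoxSpace N)), (∀ x ∈ B, (x, shift g x) ∈ relPow E n) →
        ‖π (proj B) (ξ - π (shiftMatrix N hS g) ξ)‖ ≤ K * δ := by
  classical
  induction n with
  | zero =>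
    refine ⟨0, le_rfl, fun H _ _ _ π ξ δ _ g B hB => ?_⟩
    have h1 : proj B * shiftMatrix N hS g = proj B := by
      ext x y
      rw [coeff_proj_mul, coeff_proj, coeff_shiftMatrix, ite_and]
      by_cases hx : x ∈ B
      · have : x = shift g x := hB x hx
        rw [← this, if_pos hx]
        simp [hx, eq_comm]
      · simp [hx]
    rw [map_sub, ← mul_apply_eq_comp, ← map_mul, h1, sub_self, norm_zero, zero_mul]
  | succ n ih =>
    obtain ⟨K, hK, ih⟩ := ih
    obtain ⟨F, hF, hFE⟩ := exists_finite_labels hE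
    refine ⟨hF.toFinset.card * (K + 1), by positivity, fun H _ _ _ π ξ δ hδ g B hB => ?_⟩
    -- The label of the last step of a path from `x` to `x g`.
    have hlabel : ∀ x, ∃ h : Γ, x ∈ B → h ∈ F ∧ (x, shift (g * h⁻¹) x) ∈ relPow E n ∧
        (shift (g * h⁻¹) x, shift g x) ∈ E := by
      intro x
      by_cases hx : x ∈ B
      · obtain ⟨z, h1, h2⟩ := hB x hx
        obtain ⟨h, hh, h3⟩ := mem_labelRel.1 (hFE h2)
        have h4 : z = shift (g * h⁻¹) x := by
          rw [← shift_shift]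
          exact shift_eq_iff.1 (Eq.symm h3)
        exact ⟨h, fun _ => ⟨hh, h4 ▸ h1, h4 ▸ h2⟩⟩
      · exact ⟨1, fun h => absurd h hx⟩
    choose f hf using hlabel
    rw [proj_eq_sum B hF.toFinset f fun x hx => hF.mem_toFinset.2 (hf x hx).1, map_sum,
      sum_apply, mul_assoc, ← nsmul_eq_mul]
    refine (norm_sum_le _ _).trans (Finset.sum_le_card_nsmul _ _ _ fun h _ => ?_)
    -- `1 - u_g = (1 - u_{g h⁻¹}) + u_{g h⁻¹} (1 - u_h)`, with the projection `1_C` moved past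
    -- `u_{g h⁻¹}` in the second summand.
    set C : Set (BoxSpace N) := {x ∈ B | f x = h} with hC
    have hsplit : π (proj C) (ξ - π (shiftMatrix N hS g) ξ) =
        π (proj C) (ξ - π (shiftMatrix N hS (g * h⁻¹)) ξ) +
          π (shiftMatrix N hS (g * h⁻¹)) (π (proj (shift (g * h⁻¹)⁻¹ ⁻¹' C))
            (ξ - π (shiftMatrix N hS h) ξ)) := by
      have h1 : shiftMatrix N hS g = shiftMatrix N hS (g * h⁻¹) * shiftMatrix N hS h := by
        rw [← shiftMatrix_mul, inv_mul_cancel_right]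
      rw [← mul_apply_eq_comp (π (shiftMatrix N hS (g * h⁻¹))), ← map_mul,
        ← proj_mul_shiftMatrix, h1, map_mul, map_mul, mul_apply_eq_comp, mul_apply_eq_comp,
        ← map_add]
      congr 1
      rw [map_sub]
      abel
    rw [hsplit, add_mul, one_mul]
    refine (norm_add_le _ _).trans (add_le_add ?_ ?_)
    · exact ih H π ξ δ hδ _ C fun x hx => hx.2 ▸ (hf x hx.1).2.1
    · rw [← restrictToGroup_apply, norm_unitary_apply]
      refine hδ h _ fun y hy => ?_
      have := (hf _ hy.1).2.2
      rw [hy.2, shift_shift, shift_shift, inv_mul_cancel, shift_one] at this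
      simpa using this

theorem HasKazhdanPropertyT.hasGeometricPropertyT
    (hS : Subgroup.closure (S : Set Γ) = ⊤) (hT : HasKazhdanPropertyT Γ) :
    HasGeometricPropertyT (boxCoarseStructure S N) := by
  intro E hE
  obtain ⟨c, hc, hc'⟩ := hT S hS
  obtain ⟨n, -, hn⟩ := hE.2 (boxRel S N) fun _ h => h
  obtain ⟨K, hK, hK'⟩ := norm_proj_sub_le_of_relPow (N := N) hS hE.1 n
  refine ⟨c / (K + 1), by positivity, fun H _ _ _ π ξ hξ => ?_⟩
  by_contra! hcon
  have hξ0 : ξ ≠ 0 := by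
    rintro rfl
    -- For the zero vector the empty partial translation satisfies the estimate.
    have := hcon (shiftPartial N hS 1 ∅) (by
      rw [PartialTranslation.supp_operator]
      rintro ⟨x, y⟩ h
      exact absurd ((mem_graph_shiftPartial hS).1 h).1 (Set.notMem_empty x))
    simp at this
  have hpos : 0 < ‖ξ‖ := norm_pos_iff.2 hξ0
  obtain ⟨s, hs, hsξ⟩ := hc' H (restrictToGroup hS π) ξ
    (Submodule.orthogonal_le (fixedVectors_le_constantVectors hS π) hξ) hξ0
  have hlt := hK' H π ξ (c / (K + 1) * ‖ξ‖) (fun g B hB => by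
    have := hcon (shiftPartial N hS g B) (by
      rw [PartialTranslation.supp_operator]
      rintro ⟨x, y⟩ h
      obtain ⟨hx, rfl⟩ := (mem_graph_shiftPartial hS).1 h
      exact hB x hx)
    rw [PartialTranslation.operator_mul_star, operator_shiftPartial, target_shiftPartial, map_sub,
      map_mul, sub_apply, mul_apply_eq_comp, ← map_sub] at this
    exact this.le) s Set.univ
    fun x _ => hn (by rw [boxRel_eq_labelRel]; exact ⟨s, hs, rfl⟩)
  rw [proj_univ, map_one, one_apply_eq_self, norm_sub_rev, ← restrictToGroup_apply] at hlt
  have h1 := hsξ.trans hlt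
  have h2 : K * (c / (K + 1) * ‖ξ‖) < c * ‖ξ‖ := by
    have : K / (K + 1) < 1 := (div_lt_one (by positivity)).2 (by linarith)
    calc K * (c / (K + 1) * ‖ξ‖) = K / (K + 1) * (c * ‖ξ‖) := by ring
      _ < 1 * (c * ‖ξ‖) := mul_lt_mul_of_pos_right this (by positivity)
      _ = c * ‖ξ‖ := one_mul _
  linarith

end GroupToSpace

/-! ### Sections of the quotient maps -/

section Sections

open Filter

theorem countable_of_closure_eq_top {Γ : Type u} [Group Γ] {S : Finset Γ}
    (hS : Subgroup.closure (S : Set Γ) = ⊤) : Countable Γ := by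
  refine Function.Surjective.countable (f := FreeGroup.lift (fun s : S => (s : Γ))) ?_
  rw [← MonoidHom.range_eq_top, FreeGroup.range_lift_eq_closure]
  simpa using hS

variable {Γ : Type u} [Group Γ] {N : ℕ → Subgroup Γ}

theorem eventually_mk_ne (hN : Antitone N) (hN' : ⨅ n, N n = ⊥) {g h : Γ} (hgh : g ≠ h) :
    ∀ᶠ n in atTop, (g : Γ ⧸ N n) ≠ (h : Γ ⧸ N n) := by
  have : ∃ n, g⁻¹ * h ∉ N n := by
    by_contra! hcon
    have : g⁻¹ * h ∈ ⨅ n, N n := Subgroup.mem_iInf.2 hcon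
    rw [hN', Subgroup.mem_bot, inv_mul_eq_one] at this
    exact hgh this
  obtain ⟨n, hn⟩ := this
  exact eventually_atTop.2 ⟨n, fun m hm h' => hn (hN hm (QuotientGroup.eq.1 h'))⟩

/-- There are representatives for the classes in all `Γ / Γ_n` such that every `g : Γ` is the
representative of its own class as soon as `n` is large. -/
theorem exists_representatives [Countable Γ] (hN : Antitone N) (hN' : ⨅ n, N n = ⊥) :
    ∃ r : ∀ n, Γ ⧸ N n → Γ, ∀ g : Γ, ∀ᶠ n in atTop, r n g = g := by
  -- The representative is the first member of the class in an enumeration of `Γ`.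
  obtain ⟨e, he⟩ := exists_injective_nat Γ
  have hmin : ∀ n (q : Γ ⧸ N n), ∃ g : Γ, (g : Γ ⧸ N n) = q ∧
      ∀ h : Γ, (h : Γ ⧸ N n) = q → e g ≤ e h := by
    intro n q
    obtain ⟨g, hg, hg'⟩ := (measure e).wf.has_min {g : Γ | (g : Γ ⧸ N n) = q}
      (QuotientGroup.mk_surjective q)
    exact ⟨g, hg, fun h hh => not_lt.1 (hg' h hh)⟩
  choose r hr hr' using hmin
  refine ⟨r, fun g => ?_⟩
  have hfin : {h : Γ | e h ≤ e g}.Finite := (Set.finite_Iic (e g)).preimage he.injOn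
  have hev : ∀ᶠ n in atTop, ∀ h ∈ {h : Γ | e h ≤ e g}, h ≠ g → (h : Γ ⧸ N n) ≠ (g : Γ ⧸ N n) :=
    (eventually_all_finite hfin).2 fun h _ => by
      by_cases hh : h = g
      · exact Eventually.of_forall fun n h' => absurd hh h'
      · exact (eventually_mk_ne hN hN' hh).mono fun n hn _ => hn
  refine hev.mono fun n hn => ?_
  by_contra h
  exact hn _ (hr' n g g rfl) h (hr n g)

theorem eventually_hyperfilter {p : ℕ → Prop} (h : ∀ᶠ n in atTop, p n) :
    ∀ᶠ n in (hyperfilter ℕ : Filter ℕ), p n :=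
  Nat.hyperfilter_le_atTop h

theorem eventually_forall_representative {r : ∀ n, Γ ⧸ N n → Γ}
    (hr : ∀ g : Γ, ∀ᶠ n in atTop, r n g = g) {F : Set Γ}
    (hF : F.Finite) : ∀ᶠ n in (hyperfilter ℕ : Filter ℕ), ∀ g ∈ F, r n g = g :=
  eventually_hyperfilter ((eventually_all_finite hF).2 fun g _ => hr g)

end Sections

/-! ### Schur's test -/

/-- A nonnegative matrix whose row and column sums are at most `R` has `ℓ²` operator norm at most
`R`. This is the source of the uniform bound on the blocks of a matrix in the translation algebra.
-/
theorem sum_sq_sum_mul_le {ι : Type*} [Fintype ι] (a : ι → ι → ℝ) (b : ι → ℝ) {R : ℝ}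
    (ha : ∀ x y, 0 ≤ a x y) (hrow : ∀ x, ∑ y, a x y ≤ R) (hcol : ∀ y, ∑ x, a x y ≤ R)
    (hR : 0 ≤ R) : ∑ x, (∑ y, a x y * b y) ^ 2 ≤ R ^ 2 * ∑ y, b y ^ 2 := by
  calc ∑ x, (∑ y, a x y * b y) ^ 2
      ≤ ∑ x, R * ∑ y, a x y * b y ^ 2 := by
        refine Finset.sum_le_sum fun x _ => ?_
        refine (Finset.sum_sq_le_sum_mul_sum_of_sq_le_mul _ (f := fun y => a x y)
          (g := fun y => a x y * b y ^ 2) (fun y _ => ha x y)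
          (fun y _ => mul_nonneg (ha x y) (sq_nonneg _)) fun y _ => by
            rw [mul_pow, sq (a x y), mul_assoc]).trans ?_
        exact mul_le_mul_of_nonneg_right (hrow x)
          (Finset.sum_nonneg fun y _ => mul_nonneg (ha x y) (sq_nonneg _))
    _ = R * ∑ y, (∑ x, a x y) * b y ^ 2 := by
        rw [← Finset.mul_sum, Finset.sum_comm]
        simp only [Finset.sum_mul]
    _ ≤ R * ∑ y, R * b y ^ 2 := by
        refine mul_le_mul_of_nonneg_left (Finset.sum_le_sum fun y _ => ?_) hR
        exact mul_le_mul_of_nonneg_right (hcol y) (sq_nonneg _)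
    _ = R ^ 2 * ∑ y, b y ^ 2 := by
        rw [← Finset.mul_sum]
        ring

/-! ### Vector-valued functions on the finite quotients -/

section Block

noncomputable instance fintypeQuotientOfFiniteIndex {Γ : Type u} [Group Γ] (K : Subgroup Γ)
    [K.FiniteIndex] : Fintype (Γ ⧸ K) := Fintype.ofFinite _

variable {Γ : Type u} [Group Γ] {N : ℕ → Subgroup Γ} [∀ n, (N n).FiniteIndex]
  {H : Type u} [NormedAddCommGroup H] [InnerProductSpace ℂ H]

variable (N H) in
/-- The Hilbert space of `H`-valued functions on `Γ / Γ_n`. -/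
abbrev Block (n : ℕ) : Type u := PiLp 2 fun _ : Γ ⧸ N n => H

variable (N H) in
/-- The isometric embedding of `H` as the constant functions on `Γ / Γ_n`. -/
noncomputable def constBlock (n : ℕ) : H →ₗᵢ[ℂ] Block N H n where
  toFun := fun ξ => WithLp.toLp 2 fun _ => ((√(Fintype.card (Γ ⧸ N n)))⁻¹ : ℂ) • ξ
  map_add' := fun ξ η => by ext x; simp
  map_smul' := fun c ξ => by ext x; simp [smul_comm c]
  norm_map' := fun ξ => by
    have hpos : (0 : ℝ) < Fintype.card (Γ ⧸ N n) := by exact_mod_cast Fintype.card_pos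
    refine (sq_eq_sq₀ (norm_nonneg _) (norm_nonneg _)).1 ?_
    change ‖(WithLp.toLp 2 fun _ => ((√(Fintype.card (Γ ⧸ N n)))⁻¹ : ℂ) • ξ : Block N H n)‖ ^ 2 = _
    rw [PiLp.norm_sq_eq_of_L2]
    simp only [norm_smul, mul_pow, Finset.sum_const, Finset.card_univ, nsmul_eq_mul, norm_inv,
      Complex.norm_real, inv_pow, Real.norm_eq_abs, sq_abs, Real.sq_sqrt hpos.le]
    field_simp

theorem constBlock_apply (n : ℕ) (ξ : H) (x : Γ ⧸ N n) :
    constBlock N H n ξ x = ((√(Fintype.card (Γ ⧸ N n)))⁻¹ : ℂ) • ξ := rfl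

end Block

/-! ### Representations of the translation algebra induced from the group -/

section Induced

open Filter TranslationAlgebra BoxSpace
open scoped Pointwise

variable {Γ : Type u} [Group Γ] {N : ℕ → Subgroup Γ} [∀ n, (N n).Normal] [∀ n, (N n).FiniteIndex]
  {S : Finset Γ} {H : Type u} [NormedAddCommGroup H] [InnerProductSpace ℂ H] [CompleteSpace H]

theorem exists_row_sum_le (T : TranslationAlgebra (boxCoarseStructure S N)) :
    ∃ R : ℝ, 0 ≤ R ∧ ∀ n (x : Γ ⧸ N n), ∑ y : Γ ⧸ N n, ‖T.coeff ⟨n, x⟩ ⟨n, y⟩‖ ≤ R := by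
  classical
  obtain ⟨C, hC⟩ := T.exists_bound
  obtain ⟨M, hM⟩ := T.exists_row_bound
  refine ⟨M * |C|, by positivity, fun n x => ?_⟩
  obtain ⟨s, hs, hs'⟩ := hM ⟨n, x⟩
  rw [← Finset.sum_filter_ne_zero]
  set A : Finset (Γ ⧸ N n) := {y | ‖T.coeff ⟨n, x⟩ ⟨n, y⟩‖ ≠ 0} with hA
  have hcard : A.card ≤ M := by
    refine le_trans ?_ hs
    refine Finset.card_le_card_of_injOn (fun y => (⟨n, y⟩ : BoxSpace N)) (fun y hy => ?_)
      (fun _ _ _ _ h => eq_of_heq (Sigma.mk.inj h).2)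
    refine hs' _ fun h => ?_
    have := (Finset.mem_filter.1 (Finset.mem_coe.1 hy)).2
    simp [h] at this
  refine (Finset.sum_le_card_nsmul _ _ |C| fun y _ => (hC _ _).trans (le_abs_self C)).trans ?_
  rw [nsmul_eq_mul]
  exact mul_le_mul_of_nonneg_right (by exact_mod_cast hcard) (abs_nonneg _)

theorem exists_schur_bound (T : TranslationAlgebra (boxCoarseStructure S N)) :
    ∃ R : ℝ, 0 ≤ R ∧ (∀ n (x : Γ ⧸ N n), ∑ y : Γ ⧸ N n, ‖T.coeff ⟨n, x⟩ ⟨n, y⟩‖ ≤ R) ∧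
      ∀ n (y : Γ ⧸ N n), ∑ x : Γ ⧸ N n, ‖T.coeff ⟨n, x⟩ ⟨n, y⟩‖ ≤ R := by
  obtain ⟨R, hR, h⟩ := exists_row_sum_le T
  obtain ⟨R', hR', h'⟩ := exists_row_sum_le (star T)
  refine ⟨max R R', hR.trans (le_max_left _ _), fun n x => (h n x).trans (le_max_left _ _),
    fun n y => le_trans (le_of_eq ?_) ((h' n y).trans (le_max_right _ _))⟩
  simp

/-- Entries of a product in a block are computed inside the block. -/
theorem coeff_mul_block (A B : TranslationAlgebra (boxCoarseStructure S N)) (n : ℕ)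
    (x z : Γ ⧸ N n) : (A * B).coeff ⟨n, x⟩ ⟨n, z⟩ =
      ∑ y : Γ ⧸ N n, A.coeff ⟨n, x⟩ ⟨n, y⟩ * B.coeff ⟨n, y⟩ ⟨n, z⟩ := by
  obtain ⟨F, -, hF⟩ := exists_finite_labels A.supp_mem
  rw [coeff_mul, finsum_eq_sum_of_support_subset
    (s := Finset.univ.map (Function.Embedding.sigmaMk (β := fun n => Γ ⧸ N n) n)), Finset.sum_map]
  · rfl
  · rintro w hw
    obtain ⟨g, -, rfl⟩ := mem_labelRel.1
      (hF (show (⟨n, x⟩, w) ∈ A.supp from left_ne_zero_of_mul hw))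
    simp [shift]

variable (σ : Γ →* unitary (H →L[ℂ] H)) (r : ∀ n, Γ ⧸ N n → Γ)

/-- The action of the `n`-th block of a matrix on `H`-valued functions on `Γ / Γ_n`, its `(x, y)`
entry being twisted by the unitary operator of the representative of `x⁻¹ y`. -/
noncomputable def blockOp (T : TranslationAlgebra (boxCoarseStructure S N)) (n : ℕ) :
    Block N H n →L[ℂ] Block N H n :=
  (PiLp.continuousLinearEquiv 2 ℂ fun _ : Γ ⧸ N n => H).symm.toContinuousLinearMap.comp
    (ContinuousLinearMap.pi fun x => ∑ y : Γ ⧸ N n, T.coeff ⟨n, x⟩ ⟨n, y⟩ •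
      (σ (r n (x⁻¹ * y)) : H →L[ℂ] H).comp (PiLp.proj 2 (fun _ : Γ ⧸ N n => H) y))

theorem blockOp_apply (T : TranslationAlgebra (boxCoarseStructure S N)) (n : ℕ)
    (ξ : Block N H n) (x : Γ ⧸ N n) : blockOp σ r T n ξ x =
      ∑ y : Γ ⧸ N n, T.coeff ⟨n, x⟩ ⟨n, y⟩ • (σ (r n (x⁻¹ * y)) : H →L[ℂ] H) (ξ y) := by
  simp [blockOp]

theorem exists_norm_blockOp_le (T : TranslationAlgebra (boxCoarseStructure S N)) :
    ∃ C : ℝ, ∀ n, ‖blockOp σ r T n‖ ≤ C := by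
  obtain ⟨R, hR, hrow, hcol⟩ := exists_schur_bound T
  refine ⟨R, fun n => ContinuousLinearMap.opNorm_le_bound _ hR fun ξ => ?_⟩
  refine (sq_le_sq₀ (norm_nonneg _) (by positivity)).1 ?_
  rw [mul_pow, PiLp.norm_sq_eq_of_L2, PiLp.norm_sq_eq_of_L2]
  refine le_trans (Finset.sum_le_sum fun x _ => ?_) (sum_sq_sum_mul_le
    (fun x y => ‖T.coeff ⟨n, x⟩ ⟨n, y⟩‖) (fun y => ‖ξ y‖) (fun _ _ => norm_nonneg _)
    (hrow n) (hcol n) hR)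
  refine pow_le_pow_left₀ (norm_nonneg _) ?_ 2
  rw [blockOp_apply]
  refine (norm_sum_le _ _).trans (le_of_eq (Finset.sum_congr rfl fun y _ => ?_))
  rw [norm_smul, norm_unitary_apply]

theorem blockOp_add (A B : TranslationAlgebra (boxCoarseStructure S N)) (n : ℕ) :
    blockOp σ r (A + B) n = blockOp σ r A n + blockOp σ r B n := by
  ext ξ x
  simp [blockOp_apply, add_smul, Finset.sum_add_distrib]

theorem blockOp_smul (c : ℂ) (A : TranslationAlgebra (boxCoarseStructure S N)) (n : ℕ) :
    blockOp σ r (c • A) n = c • blockOp σ r A n := by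
  ext ξ x
  simp [blockOp_apply, Finset.smul_sum, mul_smul]

theorem blockOp_one {n : ℕ} (h : r n 1 = 1) :
    blockOp σ r (1 : TranslationAlgebra (boxCoarseStructure S N)) n = 1 := by
  classical
  ext ξ x
  rw [blockOp_apply, Finset.sum_eq_single x]
  · simp [coeff_one, h]
  · intro y _ hy
    simp [coeff_one, hy.symm]
  · simp

/-- The block action is multiplicative on matrices whose labels, and products of labels,
represent their own classes: the twist `r_n(x⁻¹ y)` is then a cocycle on the entries that occur. -/
theorem blockOp_mul {A B : TranslationAlgebra (boxCoarseStructure S N)} {F G : Set Γ}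
    (hF : A.supp ⊆ labelRel N F) (hG : B.supp ⊆ labelRel N G) {n : ℕ}
    (hrF : ∀ g ∈ F, r n g = g) (hrG : ∀ g ∈ G, r n g = g) (hrFG : ∀ g ∈ F * G, r n g = g) :
    blockOp σ r (A * B) n = blockOp σ r A n * blockOp σ r B n := by
  ext ξ x
  rw [mul_apply_eq_comp, blockOp_apply, blockOp_apply]
  simp only [blockOp_apply, coeff_mul_block, Finset.sum_smul, map_sum, Finset.smul_sum]
  rw [Finset.sum_comm]
  refine Finset.sum_congr rfl fun y _ => Finset.sum_congr rfl fun z _ => ?_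
  by_cases hA : A.coeff ⟨n, x⟩ ⟨n, y⟩ = 0
  · simp [hA]
  by_cases hB : B.coeff ⟨n, y⟩ ⟨n, z⟩ = 0
  · simp [hB]
  obtain ⟨g, hg, hxy⟩ := exists_label hF hA
  obtain ⟨h, hh, hyz⟩ := exists_label hG hB
  have hxz : x⁻¹ * z = ((g * h : Γ) : Γ ⧸ N n) := by
    rw [QuotientGroup.mk_mul, ← hxy, ← hyz]
    group
  rw [hxy, hyz, hxz, hrF g hg, hrG h hh, hrFG _ (Set.mul_mem_mul hg hh), map_mul, map_smul,
    smul_smul]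
  rfl

theorem blockOp_star {A : TranslationAlgebra (boxCoarseStructure S N)} {F : Set Γ}
    (hF : A.supp ⊆ labelRel N F) {n : ℕ}
    (hrF : ∀ g ∈ F, r n g = g) (hrF' : ∀ g ∈ F⁻¹, r n g = g) :
    blockOp σ r (star A) n = star (blockOp σ r A n) := by
  refine (ContinuousLinearMap.eq_adjoint_iff _ _).2 fun ξ η => ?_
  rw [PiLp.inner_apply, PiLp.inner_apply]
  simp only [blockOp_apply, sum_inner, inner_sum]
  rw [Finset.sum_comm]
  refine Finset.sum_congr rfl fun y _ => Finset.sum_congr rfl fun x _ => ?_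
  by_cases hA : A.coeff ⟨n, y⟩ ⟨n, x⟩ = 0
  · simp [hA]
  obtain ⟨g, hg, hyx⟩ := exists_label hF hA
  have hxy : x⁻¹ * y = ((g⁻¹ : Γ) : Γ ⧸ N n) := by
    rw [QuotientGroup.mk_inv, ← hyx]
    group
  rw [hyx, hxy, hrF g hg, hrF' _ (Set.inv_mem_inv.2 hg), inner_smul_left, inner_smul_right,
    coeff_star, map_inv, ← Unitary.star_eq_inv, Unitary.coe_star,
    ContinuousLinearMap.star_eq_adjoint, ContinuousLinearMap.adjoint_inner_left]
  simp

variable {r}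

/-- The representation of the translation algebra on the ultraproduct of the spaces of `H`-valued
functions on the quotients `Γ / Γ_n`, induced by a unitary representation of `Γ` on `H`. -/
noncomputable def inducedRep (hr : ∀ g : Γ, ∀ᶠ n in atTop, r n g = g) :
    TranslationAlgebra (boxCoarseStructure S N) →⋆ₐ[ℂ]
      (Ultraproduct (Block N H) →L[ℂ] Ultraproduct (Block N H)) where
  toFun := fun T => Ultraproduct.map (blockOp σ r T) (exists_norm_blockOp_le σ r T)
  map_one' := Ultraproduct.map_eq_one _ <|
    (eventually_hyperfilter (hr 1)).mono fun _ hn => blockOp_one σ r hn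
  map_mul' := fun A B => by
    obtain ⟨F, hF, hFA⟩ := exists_finite_labels A.supp_mem
    obtain ⟨G, hG, hGB⟩ := exists_finite_labels B.supp_mem
    refine Ultraproduct.map_eq_mul _ _ _ ?_
    filter_upwards [eventually_forall_representative hr hF, eventually_forall_representative hr hG,
      eventually_forall_representative hr (hF.mul hG)] with n h1 h2 h3
    exact blockOp_mul σ r hFA hGB h1 h2 h3
  map_zero' := by
    have := Ultraproduct.map_eq_smul 0 (exists_norm_blockOp_le σ r 0)
      (exists_norm_blockOp_le σ r (0 : TranslationAlgebra (boxCoarseStructure S N)))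
      (Eventually.of_forall fun n => by rw [← blockOp_smul, smul_zero])
    rwa [zero_smul] at this
  map_add' := fun A B => Ultraproduct.map_eq_add _ _ _ <|
    Eventually.of_forall fun n => blockOp_add σ r A B n
  commutes' := fun c => by
    rw [Algebra.algebraMap_eq_smul_one, Algebra.algebraMap_eq_smul_one,
      Ultraproduct.map_eq_smul c _ (exists_norm_blockOp_le σ r 1)
        (Eventually.of_forall fun n => blockOp_smul σ r c 1 n)]
    congr 1
    exact Ultraproduct.map_eq_one _ <|
      (eventually_hyperfilter (hr 1)).mono fun _ hn => blockOp_one σ r hn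
  map_star' := fun A => by
    obtain ⟨F, hF, hFA⟩ := exists_finite_labels A.supp_mem
    refine Ultraproduct.map_eq_star _ _ ?_
    filter_upwards [eventually_forall_representative hr hF,
      eventually_forall_representative hr hF.inv] with n h1 h2
    exact blockOp_star σ r hFA h1 h2

theorem blockOp_shiftMatrix_constBlock (hS : Subgroup.closure (S : Set Γ) = ⊤) {g : Γ} {n : ℕ}
    (hg : r n g = g) (ξ : H) : blockOp σ r (shiftMatrix N hS g) n (constBlock N H n ξ) =
      constBlock N H n ((σ g : H →L[ℂ] H) ξ) := by
  ext x
  rw [blockOp_apply, Finset.sum_eq_single (x * g)]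
  · simp [coeff_shiftMatrix, shift, constBlock_apply, hg]
  · intro y _ hy
    have : ¬ (⟨n, y⟩ : BoxSpace N) = shift g ⟨n, x⟩ := fun h =>
      hy (eq_of_heq (Sigma.mk.inj h).2)
    rw [coeff_shiftMatrix, if_neg this, zero_smul]
  · simp

/-- The constant functions form a copy of the original representation of `Γ` in the induced
representation. -/
theorem inducedRep_shiftMatrix_diag (hr : ∀ g : Γ, ∀ᶠ n in atTop, r n g = g)
    (hS : Subgroup.closure (S : Set Γ) = ⊤) (g : Γ) (ξ : H) :
    inducedRep σ hr (shiftMatrix N hS g) (Ultraproduct.diag (constBlock N H) ξ) =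
      Ultraproduct.diag (constBlock N H) ((σ g : H →L[ℂ] H) ξ) :=
  Ultraproduct.map_diag_eq _ _ <| (eventually_hyperfilter (hr g)).mono fun _ hn =>
    blockOp_shiftMatrix_constBlock σ hS hn ξ

end Induced

/-! ### Geometric property (T) of the box space implies property (T) of the group -/

section SpaceToGroup

open Filter TranslationAlgebra BoxSpace

variable {Γ : Type u} [Group Γ]

/-- The displacement of a vector by `g` is at most the length of `g` as a word in `E` times the
largest displacement by an element of `E`; the constant depends on `g` and `E` only. -/
theorem exists_norm_sub_le_of_mem_closure {E : Set Γ} {g : Γ} (hg : g ∈ Subgroup.closure E) :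
    ∃ K : ℝ, 0 ≤ K ∧ ∀ (H : Type u) [NormedAddCommGroup H] [InnerProductSpace ℂ H]
      [CompleteSpace H] (σ : Γ →* unitary (H →L[ℂ] H)) (ξ : H) (δ : ℝ),
      (∀ s ∈ E, ‖(σ s : H →L[ℂ] H) ξ - ξ‖ ≤ δ) → ‖(σ g : H →L[ℂ] H) ξ - ξ‖ ≤ K * δ := by
  induction hg using Subgroup.closure_induction with
  | mem s hs => exact ⟨1, zero_le_one, fun H _ _ _ σ ξ δ h => by simpa using h s hs⟩
  | one => exact ⟨0, le_rfl, fun H _ _ _ σ ξ δ h => by simp⟩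
  | mul a b _ _ iha ihb =>
    obtain ⟨K, hK, ha⟩ := iha
    obtain ⟨L, hL, hb⟩ := ihb
    refine ⟨L + K, by positivity, fun H _ _ _ σ ξ δ h => ?_⟩
    have hsplit : (σ (a * b) : H →L[ℂ] H) ξ - ξ =
        (σ a : H →L[ℂ] H) ((σ b : H →L[ℂ] H) ξ - ξ) + ((σ a : H →L[ℂ] H) ξ - ξ) := by
      rw [map_mul, map_sub]
      simp
    rw [hsplit, add_mul]
    refine (norm_add_le _ _).trans (add_le_add ?_ (ha H σ ξ δ h))
    rw [norm_unitary_apply]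
    exact hb H σ ξ δ h
  | inv a _ iha =>
    obtain ⟨K, hK, ha⟩ := iha
    refine ⟨K, hK, fun H _ _ _ σ ξ δ h => ?_⟩
    have : ‖(σ a : H →L[ℂ] H) ((σ a⁻¹ : H →L[ℂ] H) ξ - ξ)‖ ≤ K * δ := by
      rw [map_sub, ← mul_apply_eq_comp, ← Submonoid.coe_mul, ← map_mul, mul_inv_cancel, map_one,
        norm_sub_rev]
      simpa using ha H σ ξ δ h
    rwa [norm_unitary_apply] at this

theorem exists_norm_sub_le_of_closure_eq_top {E : Set Γ} (hE : Subgroup.closure E = ⊤)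
    (F : Finset Γ) :
    ∃ K : ℝ, 0 ≤ K ∧ ∀ (H : Type u) [NormedAddCommGroup H] [InnerProductSpace ℂ H]
      [CompleteSpace H] (σ : Γ →* unitary (H →L[ℂ] H)) (ξ : H) (δ : ℝ), 0 ≤ δ →
      (∀ s ∈ E, ‖(σ s : H →L[ℂ] H) ξ - ξ‖ ≤ δ) →
        ∀ g ∈ F, ‖(σ g : H →L[ℂ] H) ξ - ξ‖ ≤ K * δ := by
  choose K hK hK' using fun g : Γ =>
    exists_norm_sub_le_of_mem_closure (E := E) (g := g) (hE ▸ Subgroup.mem_top g)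
  refine ⟨∑ g ∈ F, K g, Finset.sum_nonneg fun g _ => hK g, fun H _ _ _ σ ξ δ hδ h g hg => ?_⟩
  exact (hK' g H σ ξ δ h).trans (mul_le_mul_of_nonneg_right
    (Finset.single_le_sum (f := K) (fun g _ => hK g) hg) hδ)

variable {N : ℕ → Subgroup Γ} [∀ n, (N n).Normal] {S : Finset Γ}

/-- Adjoining the identity to `S` makes the relation reflexive, so that its powers increase and
exhaust the controlled sets; the symmetry of `S` makes them closed under inverses. -/
theorem isGenerating_labelRel [DecidableEq Γ] (hS_symm : ∀ s ∈ S, s⁻¹ ∈ S) :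
    (boxCoarseStructure S N).IsGenerating (labelRel N (insert 1 S : Finset Γ)) := by
  have hsub : boxRel S N ⊆ labelRel N (insert 1 S : Finset Γ) := by
    rw [boxRel_eq_labelRel]
    rintro p ⟨s, hs, h⟩
    exact ⟨s, by simpa using Or.inr hs, h⟩
  constructor
  · refine CoarseStructure.subset_mem _ (CoarseStructure.union_mem _ (CoarseStructure.diag_mem _)
      (show boxRel S N ∈ (boxCoarseStructure S N).controlled from fun _ h => h)) ?_
    rw [boxRel_eq_labelRel]
    rintro ⟨x, y⟩ ⟨s, hs, h⟩
    rcases Finset.mem_insert.1 (Finset.mem_coe.1 hs) with rfl | hs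
    · exact Or.inl (by simpa using h.symm)
    · exact Or.inr ⟨s, hs, h⟩
  · intro F hF
    refine hF (CoarseStructure.ofPowers _ ?_ ?_) ⟨1, le_rfl, ?_⟩
    · rintro ⟨x, y⟩ h
      exact ⟨1, by simp, by simpa using Eq.symm h⟩
    · rw [labelRel_inv]
      congr 1
      ext g
      have : g⁻¹ ∈ S ↔ g ∈ S := ⟨fun h => by simpa using hS_symm _ h, hS_symm g⟩
      simp [this]
    · simpa [relPow] using hsub

variable [∀ n, (N n).FiniteIndex]
  {H : Type u} [NormedAddCommGroup H] [InnerProductSpace ℂ H] [CompleteSpace H]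
  (σ : Γ →* unitary (H →L[ℂ] H)) {r : ∀ n, Γ ⧸ N n → Γ}
  (hr : ∀ g : Γ, ∀ᶠ n in atTop, r n g = g)

/-- The adjoint of the equivariant embedding of `H` in the induced representation maps constant
vectors to fixed vectors. -/
theorem diag_mem_orthogonal_constantVectors (hS : Subgroup.closure (S : Set Γ) = ⊤)
    {ξ : H} (hξ : ξ ∈ (fixedVectors σ)ᗮ) :
    Ultraproduct.diag (constBlock N H) ξ ∈ (constantVectors (inducedRep (S := S) σ hr))ᗮ := by
  set J := Ultraproduct.diag (constBlock N H)
  set π := inducedRep (S := S) σ hr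
  rw [Submodule.mem_orthogonal]
  intro η hη
  -- A right translation `u` is everywhere defined, so `u u* = 1`.
  have hfix (g : Γ) : π (shiftMatrix N hS g) η = η := by
    have := hη (shiftPartial N hS g Set.univ)
    rwa [PartialTranslation.operator_mul_star, target_shiftPartial, operator_shiftPartial,
      proj_univ, one_mul, map_one, one_apply_eq_self] at this
  rw [← ContinuousLinearMap.adjoint_inner_left]
  refine (Submodule.mem_orthogonal _ _).1 hξ _ fun g => ?_
  refine ext_inner_right ℂ fun ζ => ?_
  rw [← ContinuousLinearMap.adjoint_inner_right, ← ContinuousLinearMap.star_eq_adjoint,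
    ← Unitary.coe_star, Unitary.star_eq_inv, ← map_inv, ContinuousLinearMap.adjoint_inner_left,
    ContinuousLinearMap.adjoint_inner_left, ← inducedRep_shiftMatrix_diag σ hr hS,
    ← star_shiftMatrix, map_star, ContinuousLinearMap.star_eq_adjoint,
    ContinuousLinearMap.adjoint_inner_right, hfix]

/-- Writing `v = ∑ 1_{B_g} u_g`, the difference `v v* - v = ∑ 1_{B_g} (1 - u_g)` maps the copy
of `ξ` to a vector of norm at most the sum of the displacements of `ξ` by the labels `g` of `v`. -/
theorem norm_inducedRep_diag_le (hS : Subgroup.closure (S : Set Γ) = ⊤)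
    (t : PartialTranslation (boxCoarseStructure S N)) (F : Finset Γ)
    (hF : t.operator.supp ⊆ labelRel N F) {ξ : H} {δ : ℝ}
    (hδ : ∀ g ∈ F, ‖(σ g : H →L[ℂ] H) ξ - ξ‖ ≤ δ) :
    ‖inducedRep σ hr (t.operator * star t.operator - t.operator)
      (Ultraproduct.diag (constBlock N H) ξ)‖ ≤ F.card * δ := by
  rw [t.supp_operator] at hF
  obtain ⟨f, hsum, hop⟩ := exists_operator_eq_sum hS t F hF
  rw [t.operator_mul_star, hsum, hop, ← Finset.sum_sub_distrib, map_sum, sum_apply,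
    ← nsmul_eq_mul]
  refine (norm_sum_le _ _).trans (Finset.sum_le_card_nsmul _ _ _ fun g hg => ?_)
  rw [map_sub, map_mul, sub_apply, mul_apply_eq_comp, inducedRep_shiftMatrix_diag, ← map_sub,
    ← map_sub]
  refine (norm_proj_apply_le _ _ _).trans ?_
  rw [Ultraproduct.norm_diag, norm_sub_rev]
  exact hδ g hg

theorem HasGeometricPropertyT.hasKazhdanPropertyT
    (hS : Subgroup.closure (S : Set Γ) = ⊤) (hS_symm : ∀ s ∈ S, s⁻¹ ∈ S)
    (hN : Antitone N) (hN' : ⨅ n, N n = ⊥)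
    (hT : HasGeometricPropertyT (boxCoarseStructure S N)) : HasKazhdanPropertyT Γ := by
  classical
  have := countable_of_closure_eq_top hS
  obtain ⟨r, hr⟩ := exists_representatives hN hN'
  obtain ⟨c, hc, hc'⟩ := hT _ (isGenerating_labelRel hS_symm)
  intro E hE
  set F : Finset Γ := insert 1 S
  obtain ⟨K, hK, hK'⟩ := exists_norm_sub_le_of_closure_eq_top hE F
  set M : ℝ := F.card * K with hM
  have hM0 : 0 ≤ M := by positivity
  refine ⟨c / (M + 1), by positivity, fun H _ _ _ σ ξ hξ hξ0 => ?_⟩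
  by_contra! hcon
  have hpos : 0 < ‖ξ‖ := norm_pos_iff.2 hξ0
  obtain ⟨t, ht, htξ⟩ := hc' _ (inducedRep σ hr) _
    (diag_mem_orthogonal_constantVectors σ hr hS hξ)
  have hle := norm_inducedRep_diag_le σ hr hS t F ht
    (hK' H σ ξ (c / (M + 1) * ‖ξ‖) (by positivity) fun s hs => (hcon s hs).le)
  rw [Ultraproduct.norm_diag] at htξ
  have h1 := htξ.trans hle
  have h2 : F.card * (K * (c / (M + 1) * ‖ξ‖)) < c * ‖ξ‖ := by
    have : M / (M + 1) < 1 := (div_lt_one (by positivity)).2 (by linarith)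
    calc F.card * (K * (c / (M + 1) * ‖ξ‖)) = M / (M + 1) * (c * ‖ξ‖) := by rw [hM]; ring
      _ < 1 * (c * ‖ξ‖) := mul_lt_mul_of_pos_right this (by positivity)
      _ = c * ‖ξ‖ := one_mul _
  linarith

end SpaceToGroup

theorem mainTheorem2 {Γ : Type u} [Group Γ] (S : Finset Γ)
    (hS : Subgroup.closure (S : Set Γ) = ⊤) (hS_symm : ∀ s ∈ S, s⁻¹ ∈ S)
    (N : ℕ → Subgroup Γ) [∀ n, (N n).Normal] [∀ n, (N n).FiniteIndex]
    (hN_nested : Antitone N) (hN_trivial : ⨅ n, N n = ⊥) :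
    HasGeometricPropertyT (boxCoarseStructure S N) ↔ HasKazhdanPropertyT Γ :=
  ⟨fun h => h.hasKazhdanPropertyT hS hS_symm hN_nested hN_trivial,
    fun h => h.hasGeometricPropertyT hS⟩
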